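/- Let $F$ be a locally compact non-Archimedean field with ring of integers $\mathcal{O}_F$, maximal ideal $\mathfrak{p}_F$, uniformizer $\varpi$ and residue field of cardinality $q$ and characteristic $p$. Let $n\ge 1$, $G=\mathrm{GL}_n(F)$, $K=\mathrm{GL}_n(\mathcal{O}_F)$, and let $N$ be the group of upper triangular unipotent matrices in $G$. Let $\ell\ne p$ be a prime, $\overline{\mathbb{Q}}_\ell$ an algebraic closure of $\mathbb{Q}_\ell$, $\overline{\mathbb{Z}}_\ell$ its ring of integers, $\mathfrak{m}_\ell$ the maximal ideal of $\overline{\mathbb{Z}}_\ell$ and $\overline{\mathbb{F}}_\ell$ its residue field. Fix a square root $q^{1/2}$ of $q$ in $\overline{\mathbb{Q}}_\ell$, and a character $\psi:F\to\overline{\mathbb{Q}}_\ell^\times$ trivial on $\mathcal{O}_F$ but not on $\mathfrak{p}_F^{-1}$; put $\psi(u)=\psi(u_{1,2}+\dots+u_{n-1,n})$ for $u\in N$. Let $\pi$ be a smooth irreducible $\overline{\mathbb{Q}}_\ell$-representation of $G$ on a vector space $V$. A Whittaker functional is a linear form $\Lambda$ on $V$ with $\Lambda(\pi(u)v)=\psi(u)\Lambda(v)$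 for $u\in N$, $v\in V$. One says that $\pi$ is * integral if $V$ contains a $G$-stable $\overline{\mathbb{Z}}_\ell$-submodule spanned over $\overline{\mathbb{Z}}_\ell$ by a $\overline{\mathbb{Q}}_\ell$-basis of $V$; * generic if it has a non-zero Whittaker functional; its Whittaker model $\mathcal{W}(\pi,\psi)$ is then the space of functions $g\mapsto\Lambda(\pi(g)v)$ on $G$, for $v\in V$ and $\Lambda$ a Whittaker functional; * unramified if $V^K\ne 0$. The spherical Hecke algebra of compactly supported bi-$K$-invariant functions on $G$ then acts on $V^K$ (with $\mathrm{vol}(K)=1$) through a character of the form $$f\mapsto\sum_{a\in\mathbb{Z}^n} q^{\sum_j a_j(j-(n+1)/2)}\Big(\int_N f(\varpi^a u)\,du\Big)\mu_1^{a_1}\cdots\mu_n^{a_n},$$ where $\varpi^a=\mathrm{diag}(\varpi^{a_1},\dots,\varpi^{a_n})$, $\mathrm{vol}(N\cap K)=1$ and $\mu_1,\dots,\mu_n\in\overline{\mathbb{Q}}_\ell^\times$; the conjugacy class of $\mathrm{diag}(\mu_1,\dots,\mu_n)$ is the Satake parameter of $\pi$, and $\chi(\pi)=\prod_j(X-\mu_j)$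 is its characteristic polynomial. **Proposition.** Let $\pi_1,\pi_2$ be integral generic unramified smooth irreducible $\overline{\mathbb{Q}}_\ell$-representations of $G$. Assume that $\chi(\pi_1)$ and $\chi(\pi_2)$, which have coefficients in $\overline{\mathbb{Z}}_\ell$, have the same reduction mod $\mathfrak{m}_\ell$ in $\overline{\mathbb{F}}_\ell[X]$. Then, for $i=1,2$, $\mathcal{W}(\pi_i,\psi)$ contains exactly one function $W_{\pi_i}$ such that $W_{\pi_i}(gk)=W_{\pi_i}(g)$ for all $g\in G$, $k\in K$ and $W_{\pi_i}(1)=1$; the functions $W_{\pi_1}$ and $W_{\pi_2}$ are $\overline{\mathbb{Z}}_\ell$-valued on $G$; and $$W_{\pi_1}(g)\equiv W_{\pi_2}(g)\ \mathrm{mod}\ \mathfrak{m}_\ell\qquad\text{for all } g\in G.$$ -/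

import Mathlib

open scoped ValuativeRel

namespace WhittakerCong

/-! ### The coefficient field `ℚ̄_ℓ`, its ring of integers and congruences -/

/-- The ring of integers `ℤ̄_ℓ` of `ℚ̄_ℓ = PadicAlgCl ℓ`. -/
noncomputable abbrev Zbar (ℓ : ℕ) [Fact ℓ.Prime] : ValuationSubring (PadicAlgCl ℓ) :=
  (PadicAlgCl.valued ℓ).v.valuationSubring

/-- `x ≡ y mod 𝔪_ℓ` for `x, y ∈ ℚ̄_ℓ`: the difference lies in the maximal ideal of `ℤ̄_ℓ`. -/
def CongMod (ℓ : ℕ) [Fact ℓ.Prime] (x y : PadicAlgCl ℓ) : Prop :=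
  ∃ m : Zbar ℓ, m ∈ IsLocalRing.maximalIdeal (Zbar ℓ) ∧ x - y = (m : PadicAlgCl ℓ)

/-- Two polynomials over `ℚ̄_ℓ` are congruent modulo `𝔪_ℓ`, coefficient by coefficient.
When both have coefficients in `ℤ̄_ℓ`, this says that their reductions in `𝔽̄_ℓ[X]` are equal. -/
def PolyCongMod (ℓ : ℕ) [Fact ℓ.Prime] (P Q : Polynomial (PadicAlgCl ℓ)) : Prop :=
  ∀ k : ℕ, CongMod ℓ (P.coeff k) (Q.coeff k)

/-! ### The group `GL_n(F)` and some of its subgroups -/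

section Groups

variable (F : Type*) [Field F] [ValuativeRel F] (n : ℕ)

/-- `K = GL_n(𝒪_F)`, as a subgroup of `GL_n(F)`. -/
noncomputable def maxCompact : Subgroup (GL (Fin n) F) :=
  (Matrix.GeneralLinearGroup.map (n := Fin n) (algebraMap 𝒪[F] F)).range

variable {F} {n}

/-- `u` belongs to the group `N` of upper triangular unipotent matrices. -/
def IsUpperUnipotent (u : GL (Fin n) F) : Prop :=
  (∀ i, (u : Matrix (Fin n) (Fin n) F) i i = 1) ∧
    ∀ i j, j < i → (u : Matrix (Fin n) (Fin n) F) i j = 0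

/-- The sum `x_{1,2} + ⋯ + x_{n-1,n}` of the entries just above the diagonal. -/
def superdiagSum (x : GL (Fin n) F) : F :=
  ∑ i : Fin n, ∑ j : Fin n,
    if (j : ℕ) = (i : ℕ) + 1 then (x : Matrix (Fin n) (Fin n) F) i j else 0

end Groups

/-! ### Smooth, unramified and integral representations -/

section Representations

variable {F : Type*} [Field F] [ValuativeRel F] [TopologicalSpace F] {n : ℕ}
  {ℓ : ℕ} [Fact ℓ.Prime] {V : Type*} [AddCommGroup V] [Module (PadicAlgCl ℓ) V]
  (π : Representation (PadicAlgCl ℓ) (GL (Fin n) F) V)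

/-- Smoothness: every vector has an open stabilizer. -/
def IsSmooth : Prop := ∀ v : V, IsOpen {g : GL (Fin n) F | π g v = v}


/-- `v` is fixed by `K = GL_n(𝒪_F)`. -/
def IsSpherical (v : V) : Prop := ∀ k ∈ maxCompact F n, π k v = v

/-- `π` has a non-zero `K`-fixed vector. -/
def IsUnramified : Prop := ∃ v : V, v ≠ 0 ∧ IsSpherical π v

/-- `π` is integral: `V` contains a `G`-stable `ℤ̄_ℓ`-lattice, that is, a `G`-stable
`ℤ̄_ℓ`-submodule spanned over `ℤ̄_ℓ` by a `ℚ̄_ℓ`-basis of `V`. -/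
def IsIntegral : Prop :=
  ∃ B : Set V, LinearIndependent (PadicAlgCl ℓ) ((↑) : B → V) ∧
    Submodule.span (PadicAlgCl ℓ) B = ⊤ ∧
    ∀ g : GL (Fin n) F, ∀ v ∈ Submodule.span (Zbar ℓ) B, π g v ∈ Submodule.span (Zbar ℓ) B

/-! ### Whittaker models -/

/-- `Λ` is a Whittaker functional: `Λ(π(u)v) = ψ(u)Λ(v)` for all `u ∈ N`, where
`ψ(u) = ψ(u_{1,2} + ⋯ + u_{n-1,n})`. -/
def IsWhittakerFunctional (ψ : AddChar F (PadicAlgCl ℓ)) (Λ : V →ₗ[PadicAlgCl ℓ] PadicAlgCl ℓ) :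
    Prop :=
  ∀ u : GL (Fin n) F, IsUpperUnipotent u → ∀ v : V, Λ (π u v) = ψ (superdiagSum u) * Λ v

/-- `π` is generic with respect to `ψ`: it has a non-zero Whittaker functional. -/
def IsGeneric (ψ : AddChar F (PadicAlgCl ℓ)) : Prop :=
  ∃ Λ : V →ₗ[PadicAlgCl ℓ] PadicAlgCl ℓ, Λ ≠ 0 ∧ IsWhittakerFunctional π ψ Λ

/-- The Whittaker model `𝓦(π, ψ)`: all functions `g ↦ Λ(π(g)v)` with `v ∈ V` and `Λ` a Whittaker
functional. (For `π` irreducible, non-zero Whittaker functionals are unique up to scalars, so any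
single non-zero `Λ` gives the same set.) -/
def whittakerModel (ψ : AddChar F (PadicAlgCl ℓ)) : Set (GL (Fin n) F → PadicAlgCl ℓ) :=
  {W | ∃ Λ : V →ₗ[PadicAlgCl ℓ] PadicAlgCl ℓ, IsWhittakerFunctional π ψ Λ ∧
    ∃ v : V, ∀ g, W g = Λ (π g v)}

/-- `W` is a normalized spherical Whittaker function of `π`: it lies in `𝓦(π, ψ)`, is right
invariant under `K`, and takes the value `1` at `1`. -/
def IsSphericalWhittaker (ψ : AddChar F (PadicAlgCl ℓ)) (W : GL (Fin n) F → PadicAlgCl ℓ) : Prop :=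
  W ∈ whittakerModel π ψ ∧ (∀ g, ∀ k ∈ maxCompact F n, W (g * k) = W g) ∧ W 1 = 1

/-! ### Satake parameters -/

/-- The action on `K`-fixed vectors `v` of the characteristic function of `KgK` (Haar measure
giving `K` volume `1`): the sum of `π(x)v` over the cosets `xK ⊆ KgK`. -/
noncomputable def heckeOp (g : GL (Fin n) F) (v : V) : V :=
  ∑ᶠ c ∈ MulAction.orbit (maxCompact F n) (g : GL (Fin n) F ⧸ maxCompact F n), π c.out v

/-- The number of cosets `xK ⊆ KgK` that meet `ϖ^a N`, that is, the value
`∫_N 1_{KgK}(ϖ^a u) du` for the Haar measure on `N` giving `N ∩ K` volume `1`. -/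
noncomputable def unipotentIntegral (ϖ : 𝒪[F]) (g : GL (Fin n) F) (a : Fin n → ℤ) : ℕ :=
  Nat.card {c : GL (Fin n) F ⧸ maxCompact F n //
    c ∈ MulAction.orbit (maxCompact F n) (g : GL (Fin n) F ⧸ maxCompact F n) ∧
    ∃ x u : GL (Fin n) F, IsUpperUnipotent u ∧
      (x : Matrix (Fin n) (Fin n) F) =
        Matrix.diagonal (fun i => (ϖ : F) ^ a i) * (u : Matrix (Fin n) (Fin n) F) ∧
      c = (x : GL (Fin n) F ⧸ maxCompact F n)}

/-- The value `δ^{1/2}(ϖ^a) = q^{∑_j a_j (j - (n+1)/2)}` (`1 ≤ j ≤ n`) of the square root of the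
modulus character of the Borel subgroup of upper triangular matrices, `sq` being the chosen square
root of `q`. Indices in `Fin n` start from `0`. -/
noncomputable def sqrtModulus (sq : PadicAlgCl ℓ) (a : Fin n → ℤ) : PadicAlgCl ℓ :=
  sq ^ (∑ j : Fin n, a j * (2 * ((j : ℕ) : ℤ) + 1 - (n : ℤ)))

/-- The Satake transform `∑_a δ^{1/2}(ϖ^a) (∫_N 1_{KgK}(ϖ^a u) du) X^a` of the characteristic
function of `KgK`, evaluated at `X = μ`. -/
noncomputable def satakeTransform (sq : PadicAlgCl ℓ) (ϖ : 𝒪[F]) (g : GL (Fin n) F)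
    (μ : Fin n → (PadicAlgCl ℓ)ˣ) : PadicAlgCl ℓ :=
  ∑ᶠ a : Fin n → ℤ, sqrtModulus sq a * (unipotentIntegral ϖ g a : PadicAlgCl ℓ) *
    ∏ j : Fin n, (μ j : PadicAlgCl ℓ) ^ a j

/-- `diag(μ_1, …, μ_n)` represents the Satake parameter of `π`: the spherical Hecke algebra acts on
(a line in) the space of `K`-fixed vectors through the character obtained by evaluating Satake
transforms at `μ`. (The functions `1_{KgK}` form a basis of that algebra.) -/
def IsSatakeParameter (sq : PadicAlgCl ℓ) (ϖ : 𝒪[F]) (μ : Fin n → (PadicAlgCl ℓ)ˣ) : Prop :=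
  ∃ v : V, v ≠ 0 ∧ IsSpherical π v ∧
    ∀ g : GL (Fin n) F, heckeOp π g v = satakeTransform sq ϖ g μ • v

/-- The characteristic polynomial of the conjugacy class of `diag(μ_1, …, μ_n)`. -/
noncomputable def satakePoly (μ : Fin n → (PadicAlgCl ℓ)ˣ) : Polynomial (PadicAlgCl ℓ) :=
  (Matrix.diagonal fun j => (μ j : PadicAlgCl ℓ)).charpoly

end Representations

end WhittakerCong

/-! The proof avoids any explicit formula for spherical Whittaker functions and works with the
recursion that the Hecke algebra imposes on them. Let `v` be the spherical vector with Satake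
parameter `μ`, and let W(g) = Λ(π(g)v). By the Iwasawa decomposition G = NTK, W is determined by its
values w(l) at the matrices ϖ^l. These vanish unless l is dominant, i.e. antitone
(`whittaker_nondominant`). For dominant l, the Hecke operator of the minuscule double coset with r
entries ϖ and n - r entries 1 gives ∑_{|S| = r} q^{|Inv S|} w(l + ind S) = q^{r(n-r)/2} e_r(μ) w(l),
by the coset description `orbit_eq_range` and the Satake computation `satakeTransform_torus_ind`.

By `mem_of_hecke_recursion`, these relations propagate membership in a submodule from w(0) to every
w(l), over any ring where q and the eigenvalue for r = n are units. This is used twice. With the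
zero submodule it shows that Λ(v) = 0 forces W = 0, which gives the normalization W(1) = 1.
Uniqueness follows once the K-fixed vectors are known to form a line (`mem_span_of_fixed`);
uniqueness of Whittaker functionals is never needed. With the ring `congPairs` of integral pairs
congruent modulo the maximal ideal, it gives integrality and congruence of the two functions
together.

The coefficients do lie in that ring: an invariant lattice makes the eigenvalues integral and the
one for r = n a unit, q is a unit because ℓ ≠ p, and the e_r(μ) are up to sign the coefficients of
the Satake polynomial. The remaining factor ψ(u) is a root of unity. -/

namespace WhittakerCong

open Matrix

/-! ### Diagonal, permutation and unipotent matrices over a field. -/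

section FieldGroups

variable {F : Type*} [Field F] {n : ℕ}

/-- Invertible diagonal matrices. -/
def diagGL : (Fin n → Fˣ) →* GL (Fin n) F :=
  (Units.map (diagonalRingHom (Fin n) F).toMonoidHom).comp MulEquiv.piUnits.symm.toMonoidHom

theorem coe_diagGL (d : Fin n → Fˣ) :
    (diagGL d : Matrix (Fin n) (Fin n) F) = diagonal fun i => (d i : F) := rfl

theorem diagGL_mul_apply (d : Fin n → Fˣ) (g : GL (Fin n) F) (i j : Fin n) :
    ((diagGL d * g : GL (Fin n) F) : Matrix (Fin n) (Fin n) F) i j = d i * g.1 i j := by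
  rw [Units.val_mul, coe_diagGL, diagonal_mul]

theorem mul_diagGL_apply (d : Fin n → Fˣ) (g : GL (Fin n) F) (i j : Fin n) :
    ((g * diagGL d : GL (Fin n) F) : Matrix (Fin n) (Fin n) F) i j = g.1 i j * d j := by
  rw [Units.val_mul, coe_diagGL, mul_diagonal]

/-- The matrix `diag(ϖ ^ a₁, …, ϖ ^ aₙ)`. -/
def torus (ϖ : Fˣ) (a : Fin n → ℤ) : GL (Fin n) F := diagGL fun i => ϖ ^ a i

theorem torus_add (ϖ : Fˣ) (a b : Fin n → ℤ) : torus ϖ (a + b) = torus ϖ a * torus ϖ b := by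
  rw [torus, torus, torus, ← map_mul]
  congr 1
  exact funext fun i => _root_.zpow_add ϖ (a i) (b i)

theorem torus_zero (ϖ : Fˣ) : torus ϖ (0 : Fin n → ℤ) = 1 := by
  rw [torus, ← map_one diagGL]
  congr 1
  exact funext fun i => zpow_zero ϖ

theorem torus_neg (ϖ : Fˣ) (a : Fin n → ℤ) : torus ϖ (-a) = (torus ϖ a)⁻¹ := by
  rw [eq_inv_iff_mul_eq_one, ← torus_add, neg_add_cancel, torus_zero]

/-- The permutation matrix acting on columns by `σ`. -/
def permGL (σ : Equiv.Perm (Fin n)) : GL (Fin n) F where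
  val := (1 : Matrix (Fin n) (Fin n) F).submatrix id σ
  inv := (1 : Matrix (Fin n) (Fin n) F).submatrix σ id
  val_inv := by
    rw [submatrix_mul_equiv, Matrix.mul_one, submatrix_id_id]
  inv_val := by
    rw [← submatrix_mul _ _ _ _ _ Function.bijective_id, Matrix.mul_one, submatrix_one_equiv]

theorem mul_permGL_apply (g : GL (Fin n) F) (σ : Equiv.Perm (Fin n)) (i j : Fin n) :
    ((g * permGL σ : GL (Fin n) F) : Matrix (Fin n) (Fin n) F) i j = g.1 i (σ j) := by
  simp [permGL, mul_apply, one_apply]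

theorem permGL_conj_diagGL (σ : Equiv.Perm (Fin n)) (d : Fin n → Fˣ) :
    diagGL d * permGL σ = permGL σ * diagGL (d ∘ σ) := by
  ext i j
  rw [mul_permGL_apply, mul_diagGL_apply]
  simp only [coe_diagGL, diagonal_apply, permGL, submatrix_apply, one_apply, id, Function.comp]
  split_ifs with h <;> simp [h]

/-- The group of upper triangular unipotent matrices. -/
def upperUnipotent : Subgroup (GL (Fin n) F) where
  carrier := {u | IsUpperUnipotent u}
  one_mem' := ⟨fun i => by simp, fun i j h => by simp [h.ne']⟩
  mul_mem' := by
    rintro a b ⟨ha, ha'⟩ ⟨hb, hb'⟩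
    refine ⟨fun i => ?_, fun i j hij => ?_⟩
    · rw [Units.val_mul, mul_apply, Finset.sum_eq_single i, ha, hb, one_mul]
      · intro k _ hk
        rcases lt_or_gt_of_ne hk with h | h
        · rw [ha' _ _ h, zero_mul]
        · rw [hb' _ _ h, mul_zero]
      · simp
    · rw [Units.val_mul, mul_apply]
      refine Finset.sum_eq_zero fun k _ => ?_
      rcases lt_or_ge k i with h | h
      · rw [ha' _ _ h, zero_mul]
      · rw [hb' _ _ (hij.trans_le h), mul_zero]
  inv_mem' := by
    rintro a ⟨ha, ha'⟩
    have hinv : ∀ i j, j < i → ((a⁻¹ : GL (Fin n) F) : Matrix (Fin n) (Fin n) F) i j = 0 := by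
      intro i j hij
      rw [coe_units_inv]
      exact blockTriangular_inv_of_blockTriangular (b := id) (fun i j h => ha' i j h) hij
    refine ⟨fun i => ?_, hinv⟩
    have h1 : ((a * a⁻¹ : GL (Fin n) F) : Matrix (Fin n) (Fin n) F) i i = 1 := by simp
    rw [Units.val_mul, mul_apply, Finset.sum_eq_single i, ha, one_mul] at h1
    · exact h1
    · intro k _ hk
      rcases lt_or_gt_of_ne hk with h | h
      · rw [ha' _ _ h, zero_mul]
      · rw [hinv _ _ h, mul_zero]
    · simp

theorem conj_diagGL_mem {u : GL (Fin n) F} (hu : u ∈ upperUnipotent) (d : Fin n → Fˣ) :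
    diagGL d * u * (diagGL d)⁻¹ ∈ upperUnipotent := by
  rw [← map_inv]
  refine ⟨fun i => ?_, fun i j h => ?_⟩ <;> rw [mul_diagGL_apply, diagGL_mul_apply]
  · rw [hu.1]; simp
  · rw [hu.2 _ _ h]; simp

end FieldGroups

/-! ### Membership criteria for the maximal compact subgroup. -/

section ValuedGroups

variable {F : Type*} [Field F] [ValuativeRel F] {n : ℕ}

theorem coe_eq_map_of_integral {M : Matrix (Fin n) (Fin n) F} (h : ∀ i j, M i j ∈ 𝒪[F]) :
    ∃ A : Matrix (Fin n) (Fin n) 𝒪[F], M = A.map (algebraMap 𝒪[F] F) :=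
  ⟨fun i j => ⟨M i j, h i j⟩, rfl⟩

theorem mul_integral {A B : Matrix (Fin n) (Fin n) F} (hA : ∀ i j, A i j ∈ 𝒪[F])
    (hB : ∀ i j, B i j ∈ 𝒪[F]) (i j : Fin n) : (A * B) i j ∈ 𝒪[F] := by
  rw [mul_apply]
  exact sum_mem fun k _ => mul_mem (hA i k) (hB k j)

theorem mem_maxCompact_iff {g : GL (Fin n) F} : g ∈ maxCompact F n ↔
    (∀ i j, (g : Matrix (Fin n) (Fin n) F) i j ∈ 𝒪[F]) ∧
      ∀ i j, ((g⁻¹ : GL (Fin n) F) : Matrix (Fin n) (Fin n) F) i j ∈ 𝒪[F] := by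
  constructor
  · rintro ⟨k, rfl⟩
    refine ⟨fun i j => ?_, fun i j => ?_⟩
    · rw [GeneralLinearGroup.map_apply]; exact ((k : Matrix (Fin n) (Fin n) 𝒪[F]) i j).2
    · rw [← map_inv, GeneralLinearGroup.map_apply]
      exact (((k⁻¹ : GL (Fin n) 𝒪[F]) : Matrix (Fin n) (Fin n) 𝒪[F]) i j).2
  · rintro ⟨h₁, h₂⟩
    obtain ⟨A, hA⟩ := coe_eq_map_of_integral h₁
    obtain ⟨B, hB⟩ := coe_eq_map_of_integral h₂
    have inj : Function.Injective fun M : Matrix (Fin n) (Fin n) 𝒪[F] =>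
        M.map (algebraMap 𝒪[F] F) := Matrix.map_injective (IsFractionRing.injective 𝒪[F] F)
    have hAB : A * B = 1 := inj <| by
      simp only [Matrix.map_mul, ← hA, ← hB, ← Units.val_mul]; simp
    have hBA : B * A = 1 := inj <| by
      simp only [Matrix.map_mul, ← hA, ← hB, ← Units.val_mul]; simp
    exact ⟨⟨A, B, hAB, hBA⟩, Units.ext hA.symm⟩

theorem mem_maxCompact_of_det {g : GL (Fin n) F}
    (h : ∀ i j, (g : Matrix (Fin n) (Fin n) F) i j ∈ 𝒪[F])
    (hd : ValuativeRel.valuation F (g : Matrix (Fin n) (Fin n) F).det = 1) :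
    g ∈ maxCompact F n := by
  obtain ⟨A, hA⟩ := coe_eq_map_of_integral h
  have hu : IsUnit A.det := by
    rw [(Valuation.integer.integers (ValuativeRel.valuation F)).isUnit_iff_valuation_eq_one,
      RingHom.map_det, RingHom.mapMatrix_apply, ← hA, hd]
  exact ⟨GeneralLinearGroup.mk'' A hu, Units.ext hA.symm⟩

theorem diagGL_mem_maxCompact {d : Fin n → Fˣ}
    (h : ∀ i, ValuativeRel.valuation F (d i : F) = 1) : diagGL d ∈ maxCompact F n := by
  refine mem_maxCompact_of_det (fun i j => ?_) ?_
  · rw [coe_diagGL, diagonal_apply]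
    split_ifs
    · exact (h i).le
    · exact zero_mem _
  · rw [coe_diagGL, det_diagonal, map_prod]
    exact Finset.prod_eq_one fun i _ => h i

theorem permGL_mem_maxCompact (σ : Equiv.Perm (Fin n)) :
    permGL σ ∈ maxCompact F n := by
  refine mem_maxCompact_iff.2 ⟨fun i j => ?_, fun i j => ?_⟩
  · change (1 : Matrix (Fin n) (Fin n) F) i (σ j) ∈ _
    rw [one_apply]
    split_ifs <;> simp [zero_mem, one_mem]
  · change (1 : Matrix (Fin n) (Fin n) F) (σ i) j ∈ _
    rw [one_apply]
    split_ifs <;> simp [zero_mem, one_mem]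

theorem unipotent_mem_maxCompact {u : GL (Fin n) F} (hu : u ∈ upperUnipotent)
    (h : ∀ i j, i < j → (u : Matrix (Fin n) (Fin n) F) i j ∈ 𝒪[F]) : u ∈ maxCompact F n := by
  refine mem_maxCompact_of_det (fun i j => ?_) ?_
  · rcases lt_trichotomy i j with hij | rfl | hij
    · exact h i j hij
    · rw [hu.1]; exact one_mem _
    · rw [hu.2 _ _ hij]; exact zero_mem _
  · rw [det_of_isUpperTriangular (fun i j h => hu.2 i j h)]
    simp [hu.1]

theorem exists_zpow_mul_unit [IsDiscreteValuationRing 𝒪[F]] {ϖ : 𝒪[F]} (hϖ : Irreducible ϖ)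
    {x : F} (hx : x ≠ 0) :
    ∃ a : ℤ, ∃ e : F, ValuativeRel.valuation F e = 1 ∧ x = (ϖ : F) ^ a * e := by
  have key : ∀ z : 𝒪[F], z ≠ 0 → ∃ a : ℕ, ∃ e : F, ValuativeRel.valuation F e = 1 ∧
      (z : F) = (ϖ : F) ^ a * e := by
    intro z hz
    obtain ⟨a, e, rfl⟩ := IsDiscreteValuationRing.eq_unit_mul_pow_irreducible hz hϖ
    refine ⟨a, (e : 𝒪[F]), ?_, by push_cast; ring⟩
    exact (Valuation.integer.integers (ValuativeRel.valuation F)).isUnit_iff_valuation_eq_one.1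
      e.isUnit
  have h0 : (ϖ : F) ≠ 0 := fun h => hϖ.ne_zero (Subtype.ext h)
  obtain ⟨b, c, hc, rfl⟩ := IsFractionRing.div_surjective (A := 𝒪[F]) x
  have hc0 : c ≠ 0 := nonZeroDivisors.ne_zero hc
  have hb0 : b ≠ 0 := by rintro rfl; simp at hx
  obtain ⟨m, e, he, hm⟩ := key b hb0
  obtain ⟨k, f, hf, hk⟩ := key c hc0
  refine ⟨m - k, e / f, by rw [map_div₀, he, hf, div_one], ?_⟩
  change (b : F) / (c : F) = _
  have hf0 : f ≠ 0 := by rintro rfl; simp at hf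
  rw [hm, hk, zpow_sub₀ h0]
  simp only [zpow_natCast]
  field_simp

end ValuedGroups

/-! ### Abelian unipotent matrices attached to a subset of the indices. -/

section FieldGroups

variable {F : Type*} [Field F] {n : ℕ}

/-- The invertible matrix `1 + E`, where `E ^ 2 = 0`. -/
def oneAddGL (E : Matrix (Fin n) (Fin n) F) (h : E * E = 0) : GL (Fin n) F where
  val := 1 + E
  inv := 1 - E
  val_inv := by simp [mul_sub, add_mul, h]
  inv_val := by simp [mul_add, sub_mul, h]

theorem coe_oneAddGL {E : Matrix (Fin n) (Fin n) F} (h : E * E = 0) :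
    (oneAddGL E h : Matrix (Fin n) (Fin n) F) = 1 + E := rfl

theorem coe_oneAddGL_inv {E : Matrix (Fin n) (Fin n) F} (h : E * E = 0) :
    (((oneAddGL E h)⁻¹ : GL (Fin n) F) : Matrix (Fin n) (Fin n) F) = 1 - E := rfl

/-- The pairs `i < j` with `i ∈ S` and `j ∉ S`. -/
abbrev Inv (S : Finset (Fin n)) : Type := {p : Fin n × Fin n // p.1 < p.2 ∧ p.1 ∈ S ∧ p.2 ∉ S}

/-- The matrix with entries `x` at the positions in `Inv S`, and `0` elsewhere. -/
def invMatrix (S : Finset (Fin n)) (x : Inv S → F) : Matrix (Fin n) (Fin n) F :=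
  fun i j => if h : i < j ∧ i ∈ S ∧ j ∉ S then x ⟨(i, j), h⟩ else 0

theorem invMatrix_apply_of_not {S : Finset (Fin n)} (x : Inv S → F) {i j : Fin n}
    (h : ¬ (i < j ∧ i ∈ S ∧ j ∉ S)) : invMatrix S x i j = 0 := dif_neg h

theorem invMatrix_mul (S : Finset (Fin n)) (x y : Inv S → F) :
    invMatrix S x * invMatrix S y = 0 := by
  ext i j
  rw [mul_apply, Matrix.zero_apply]
  refine Finset.sum_eq_zero fun k _ => ?_
  by_cases hk : k ∈ S
  · rw [invMatrix_apply_of_not x (fun h => h.2.2 hk), zero_mul]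
  · rw [invMatrix_apply_of_not y (fun h => hk h.2.1), mul_zero]

/-- The unipotent matrix with entries `x` at the positions in `Inv S`. -/
def invGL (S : Finset (Fin n)) (x : Inv S → F) : GL (Fin n) F :=
  oneAddGL (invMatrix S x) (invMatrix_mul S x x)

theorem invGL_mem_upperUnipotent (S : Finset (Fin n)) (x : Inv S → F) :
    invGL S x ∈ upperUnipotent := by
  refine ⟨fun i => ?_, fun i j h => ?_⟩
  · rw [invGL, coe_oneAddGL, Matrix.add_apply, one_apply_eq,
      invMatrix_apply_of_not x (by simp), add_zero]
  · rw [invGL, coe_oneAddGL, Matrix.add_apply, one_apply_ne h.ne',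
      invMatrix_apply_of_not x (fun h' => h.not_gt h'.1), add_zero]

/-- The indicator of `S` with integral values. -/
def ind (S : Finset (Fin n)) : Fin n → ℤ := fun i => if i ∈ S then 1 else 0

theorem exists_perm_ind {S T : Finset (Fin n)} (h : S.card = T.card) :
    ∃ σ : Equiv.Perm (Fin n), ind S ∘ σ = ind T := by
  let e : {x // x ∈ T} ≃ {x // x ∈ S} := Fintype.equivOfCardEq (by simp [h])
  refine ⟨e.extendSubtype, funext fun i => ?_⟩
  by_cases hi : i ∈ T
  · simp [ind, hi, e.extendSubtype_mem i hi]
  · simp [ind, hi, e.extendSubtype_not_mem i hi]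

end FieldGroups

/-! ### The Iwasawa decomposition. -/

section ValuedGroups

variable {F : Type*} [Field F] [ValuativeRel F] {n : ℕ}

theorem oneAddGL_mem_maxCompact {E : Matrix (Fin n) (Fin n) F} (h : E * E = 0)
    (hE : ∀ i j, E i j ∈ 𝒪[F]) : oneAddGL E h ∈ maxCompact F n := by
  have h1 : ∀ i j, (1 : Matrix (Fin n) (Fin n) F) i j ∈ 𝒪[F] := fun i j => by
    rw [one_apply]; split_ifs
    · exact one_mem _
    · exact zero_mem _
  refine mem_maxCompact_iff.2 ⟨fun i j => ?_, fun i j => ?_⟩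
  · exact add_mem (h1 i j) (hE i j)
  · exact sub_mem (h1 i j) (hE i j)

theorem invGL_mem_maxCompact {S : Finset (Fin n)} {x : Inv S → F} (hx : ∀ p, x p ∈ 𝒪[F]) :
    invGL S x ∈ maxCompact F n := by
  refine oneAddGL_mem_maxCompact _ fun i j => ?_
  rw [invMatrix]
  split_ifs with h
  · exact hx _
  · exact zero_mem _

/-- Gaussian elimination by integral column operations, from the bottom row upwards; `m` counts the
rows already cleared. -/
theorem exists_mul_upper_rows (g : GL (Fin n) F) (m : ℕ) :
    ∃ k ∈ maxCompact F n, ∀ i j : Fin n, n ≤ i + m → j < i →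
      ((g * k : GL (Fin n) F) : Matrix (Fin n) (Fin n) F) i j = 0 := by
  induction m with
  | zero => exact ⟨1, one_mem _, fun i j h => absurd h (by have := i.2; omega)⟩
  | succ m ih =>
    obtain ⟨k, hk, hz⟩ := ih
    by_cases hm : n ≤ m
    · exact ⟨k, hk, fun i j _ hij => hz i j (by omega) hij⟩
    let i₀ : Fin n := ⟨n - m - 1, by omega⟩
    have hi₀ : (i₀ : ℕ) = n - m - 1 := rfl
    set h := g * k with hh
    -- The pivot is an entry of largest valuation among the columns up to the diagonal, so dividing
    -- the others by it gives integral multipliers.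
    obtain ⟨j₀, hj₀, hmax⟩ := Finset.exists_max_image (Finset.Iic i₀)
      (fun j => ValuativeRel.valuation F (h.1 i₀ j)) ⟨i₀, by simp⟩
    rw [Finset.mem_Iic] at hj₀
    simp only [Finset.mem_Iic] at hmax
    by_cases h0 : h.1 i₀ j₀ = 0
    · refine ⟨k, hk, fun i j hi hij => ?_⟩
      rcases eq_or_ne i i₀ with rfl | hne
      · have := hmax j hij.le
        rw [h0, map_zero, le_zero_iff, map_eq_zero] at this
        exact this
      · exact hz i j (by have : (i : ℕ) ≠ i₀ := fun e => hne (Fin.ext e)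
                         omega) hij
    let c : Fin n → F := fun b => -(h.1 i₀ (Equiv.swap j₀ i₀ b) / h.1 i₀ j₀)
    let E : Matrix (Fin n) (Fin n) F := fun a b => if a = i₀ ∧ b < i₀ then c b else 0
    have hE : E * E = 0 := by
      ext a b
      rw [mul_apply, Matrix.zero_apply]
      refine Finset.sum_eq_zero fun l _ => ?_
      by_cases hl : l = i₀
      · simp [E, hl]
      · simp [E, hl]
    have hswap : ∀ b ≤ i₀, Equiv.swap j₀ i₀ b ≤ i₀ := by
      intro b hb
      rw [Equiv.swap_apply_def]
      split_ifs
      · exact le_rfl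
      · exact hj₀
      · exact hb
    have hc : ∀ b ≤ i₀, c b ∈ 𝒪[F] := by
      intro b hb
      refine neg_mem ?_
      rw [Valuation.mem_integer_iff, map_div₀]
      exact div_le_one_of_le₀ (hmax _ (hswap b hb)) zero_le
    refine ⟨k * (permGL (Equiv.swap j₀ i₀) * oneAddGL E hE),
      mul_mem hk (mul_mem (permGL_mem_maxCompact _) (oneAddGL_mem_maxCompact hE ?_)), ?_⟩
    · intro a b
      simp only [E]
      split_ifs with hab
      · exact hc b hab.2.le
      · exact zero_mem _
    · intro i j hi hij
      have hval : ((g * (k * (permGL (Equiv.swap j₀ i₀) * oneAddGL E hE)) : GL (Fin n) F) :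
          Matrix (Fin n) (Fin n) F) i j = h.1 i (Equiv.swap j₀ i₀ j) +
            if j < i₀ then h.1 i j₀ * c j else 0 := by
        rw [← mul_assoc, ← mul_assoc, ← hh, Units.val_mul, coe_oneAddGL, Matrix.mul_add,
          Matrix.mul_one, Matrix.add_apply, mul_permGL_apply, mul_apply, Finset.sum_eq_single i₀]
        · rw [mul_permGL_apply, Equiv.swap_apply_right]
          by_cases hj : j < i₀ <;> simp [E, hj]
        · intro l _ hl
          simp [E, hl]
        · simp
      rw [hval]
      rcases eq_or_ne i i₀ with rfl | hne
      · rw [if_pos hij]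
        simp only [c]
        field_simp
        ring
      · have hlt : i₀ < i := by
          have : (i : ℕ) ≠ i₀ := fun e => hne (Fin.ext e)
          exact Fin.lt_def.2 (by omega)
        have hi' : n ≤ i + m := by have := Fin.lt_def.1 hlt; omega
        have h1 : h.1 i j₀ = 0 := hz i j₀ hi' (hj₀.trans_lt hlt)
        have h2 : h.1 i (Equiv.swap j₀ i₀ j) = 0 := by
          refine hz i _ hi' ?_
          rcases le_or_gt j i₀ with hj | hj
          · exact (hswap j hj).trans_lt hlt
          · rwa [Equiv.swap_apply_of_ne_of_ne (hj₀.trans_lt hj).ne' hj.ne']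
        rw [h1, h2]; simp

/-- The Iwasawa decomposition. -/
theorem exists_iwasawa [IsDiscreteValuationRing 𝒪[F]] {ϖ : 𝒪[F]} (hϖ : Irreducible ϖ) {t : Fˣ}
    (ht : (t : F) = ϖ) (g : GL (Fin n) F) :
    ∃ u ∈ upperUnipotent, ∃ a : Fin n → ℤ, ∃ k ∈ maxCompact F n, g = u * torus t a * k := by
  obtain ⟨k, hk, hz⟩ := exists_mul_upper_rows g n
  replace hz : ∀ i j : Fin n, j < i →
      ((g * k : GL (Fin n) F) : Matrix (Fin n) (Fin n) F) i j = 0 :=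
    fun i j h => hz i j (by omega) h
  have hd : ∀ i, (g * k).1 i i ≠ 0 := by
    have := (GeneralLinearGroup.det (g * k)).ne_zero
    rw [GeneralLinearGroup.val_det_apply, det_of_isUpperTriangular (fun i j h => hz i j h)] at this
    exact fun i => (Finset.prod_ne_zero_iff.1 this) i (Finset.mem_univ _)
  choose a e he hae using fun i => exists_zpow_mul_unit hϖ (hd i)
  have he0 : ∀ i, e i ≠ 0 := fun i h => by simpa [h] using he i
  let E : Fin n → Fˣ := fun i => Units.mk0 (e i) (he0 i)
  have hE : diagGL E ∈ maxCompact F n := diagGL_mem_maxCompact he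
  refine ⟨g * k * (diagGL E)⁻¹ * (torus t a)⁻¹, ⟨fun i => ?_, fun i j h => ?_⟩, a,
    diagGL E * k⁻¹, mul_mem hE (inv_mem hk), by group⟩
  · rw [← map_inv, torus, ← map_inv, mul_diagGL_apply, mul_diagGL_apply, hae i, ← ht]
    have : (t : F) ^ a i ≠ 0 := zpow_ne_zero _ t.ne_zero
    simp [E, he0 i, this]
  · rw [← map_inv, torus, ← map_inv, mul_diagGL_apply, mul_diagGL_apply, hz i j h]
    simp

theorem valuation_uniformizer_lt_one {ϖ : 𝒪[F]} (hϖ : Irreducible ϖ) :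
    ValuativeRel.valuation F (ϖ : F) < 1 := by
  refine lt_of_le_of_ne ϖ.2 fun h => hϖ.not_isUnit ?_
  exact (Valuation.integer.integers (ValuativeRel.valuation F)).isUnit_iff_valuation_eq_one.2 h

theorem zpow_mem_integer_iff {ϖ : 𝒪[F]} (hϖ : Irreducible ϖ) {t : Fˣ} (ht : (t : F) = ϖ) {a : ℤ} :
    ((t ^ a : Fˣ) : F) ∈ 𝒪[F] ↔ 0 ≤ a := by
  have hlt := valuation_uniformizer_lt_one hϖ
  rw [← ht] at hlt
  have hpos : 0 < ValuativeRel.valuation F (t : F) := by simp [zero_lt_iff]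
  rw [Valuation.mem_integer_iff, Units.val_zpow_eq_zpow_val, map_zpow₀]
  constructor
  · intro h
    by_contra! ha
    exact h.not_gt (one_lt_zpow_of_neg₀ hpos hlt ha)
  · intro h
    lift a to ℕ using h
    rw [zpow_natCast]
    exact pow_le_one₀ hpos.le hlt.le

end ValuedGroups

section FieldGroups

variable {F : Type*} [Field F] {n : ℕ}

theorem torus_mul_apply (t : Fˣ) (a : Fin n → ℤ) (g : GL (Fin n) F) (i j : Fin n) :
    ((torus t a * g : GL (Fin n) F) : Matrix (Fin n) (Fin n) F) i j =
      ((t ^ a i : Fˣ) : F) * g.1 i j := diagGL_mul_apply _ _ _ _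

theorem mul_torus_apply (t : Fˣ) (a : Fin n → ℤ) (g : GL (Fin n) F) (i j : Fin n) :
    ((g * torus t a : GL (Fin n) F) : Matrix (Fin n) (Fin n) F) i j =
      g.1 i j * ((t ^ a j : Fˣ) : F) := mul_diagGL_apply _ _ _ _

theorem torus_const_comm (t : Fˣ) (c : ℤ) (g : GL (Fin n) F) :
    torus t (fun _ => c) * g = g * torus t (fun _ => c) := by
  ext i j
  rw [torus_mul_apply, mul_torus_apply, mul_comm]

theorem torus_conj_mem (t : Fˣ) (a : Fin n → ℤ) {u : GL (Fin n) F} (hu : u ∈ upperUnipotent) :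
    torus t a * u * (torus t a)⁻¹ ∈ upperUnipotent := conj_diagGL_mem hu _

theorem torus_conj_mem' (t : Fˣ) (a : Fin n → ℤ) {u : GL (Fin n) F} (hu : u ∈ upperUnipotent) :
    (torus t a)⁻¹ * u * torus t a ∈ upperUnipotent := by
  have := torus_conj_mem t (-a) hu
  rwa [torus_neg, inv_inv] at this

theorem det_torus (t : Fˣ) (a : Fin n → ℤ) :
    (torus t a : Matrix (Fin n) (Fin n) F).det = ((t ^ ∑ i, a i : Fˣ) : F) := by
  rw [torus, coe_diagGL, det_diagonal, ← Units.coe_prod]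
  congr 1
  exact (map_sum (zpowersHom Fˣ t).toAdditiveRight a Finset.univ).symm

theorem sum_ind (S : Finset (Fin n)) : ∑ i, ind S i = S.card := by
  simp [ind]

theorem ind_injective : Function.Injective (ind : Finset (Fin n) → Fin n → ℤ) := by
  intro S T h
  ext i
  have := congrFun h i
  by_cases h1 : i ∈ S <;> by_cases h2 : i ∈ T <;> simp_all [ind]

end FieldGroups

/-! ### Uniqueness of Iwasawa exponents; row reduction modulo the uniformizer. -/

section ValuedGroups

variable {F : Type*} [Field F] [ValuativeRel F] {n : ℕ} {ϖ : 𝒪[F]} {t : Fˣ}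

theorem valuation_det_of_mem {k : GL (Fin n) F} (hk : k ∈ maxCompact F n) :
    ValuativeRel.valuation F (k : Matrix (Fin n) (Fin n) F).det = 1 := by
  obtain ⟨k, rfl⟩ := hk
  rw [← GeneralLinearGroup.val_det_apply, GeneralLinearGroup.map_det, Units.coe_map]
  exact (Valuation.integer.integers (ValuativeRel.valuation F)).isUnit_iff_valuation_eq_one.1
    (GeneralLinearGroup.det k).isUnit

theorem torus_entries_integral (hϖ : Irreducible ϖ) (ht : (t : F) = ϖ) {a : Fin n → ℤ}
    (ha : ∀ i, 0 ≤ a i) (i j : Fin n) : (torus t a : Matrix (Fin n) (Fin n) F) i j ∈ 𝒪[F] := by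
  rw [torus, coe_diagGL, diagonal_apply]
  split_ifs
  · exact (zpow_mem_integer_iff hϖ ht).2 (ha i)
  · exact zero_mem _

/-- The exponents in the Iwasawa decomposition are unique. -/
theorem torus_exponent_unique (hϖ : Irreducible ϖ) (ht : (t : F) = ϖ) {u u' : GL (Fin n) F}
    (hu : u ∈ upperUnipotent) (hu' : u' ∈ upperUnipotent) {a b : Fin n → ℤ}
    (h : (u * torus t a)⁻¹ * (u' * torus t b) ∈ maxCompact F n) : a = b := by
  -- The diagonal entries of the product are ϖ^(b i - a i), and integrality gives one inequality;
  -- the inverse gives the other.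
  have key : ∀ {u u' : GL (Fin n) F}, u ∈ upperUnipotent → u' ∈ upperUnipotent →
      ∀ {a b : Fin n → ℤ}, (u * torus t a)⁻¹ * (u' * torus t b) ∈ maxCompact F n → a ≤ b := by
    intro u u' hu hu' a b h i
    have h1 := (mem_maxCompact_iff.1 h).1 i i
    have h2 : (u * torus t a)⁻¹ * (u' * torus t b) =
        torus t (-a) * ((u⁻¹ * u') * torus t b) := by
      rw [torus_neg]; group
    have h3 : (u⁻¹ * u').1 i i = 1 := (upperUnipotent.mul_mem (inv_mem hu) hu').1 i
    rw [h2, torus_mul_apply, mul_torus_apply, h3, one_mul, ← Units.val_mul, ← _root_.zpow_add,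
      zpow_mem_integer_iff hϖ ht] at h1
    simp at h1
    linarith
  refine le_antisymm (key hu hu' h) (key hu' hu ?_)
  have := inv_mem h
  rwa [_root_.mul_inv_rev, inv_inv] at this

/-- Row i of w * y expresses row i of y, modulo c, through later rows. Those indexed by S are
eliminated by descending induction, which leaves only rows outside S. In the application w = ϖ y⁻¹
and c = ϖ. -/
theorem exists_row_relation {w y : Matrix (Fin n) (Fin n) F} {S : Finset (Fin n)}
    {c : F} (hw : ∀ i j, w i j ∈ 𝒪[F]) (hw0 : ∀ i j, j < i → w i j = 0)
    (hw1 : ∀ i ∈ S, w i i = 1) (hwy : ∀ i b, ∃ z ∈ 𝒪[F], (w * y) i b = c * z) (i : Fin n)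
    (hi : i ∈ S) :
    ∃ x : Fin n → F, (∀ j, x j ∈ 𝒪[F]) ∧ (∀ j, ¬ (i < j ∧ j ∉ S) → x j = 0) ∧
      ∀ b, ∃ z ∈ 𝒪[F], y i b + ∑ j, x j * y j b = c * z := by
  induction i using WellFoundedGT.induction with
  | ind i ih =>
    have : ∀ j, ∃ x : Fin n → F, (∀ l, x l ∈ 𝒪[F]) ∧ (i < j → ∀ l, ¬ (j < l ∧ l ∉ S) → x l = 0) ∧
        (i < j → j ∈ S → ∀ b, ∃ z ∈ 𝒪[F], y j b + ∑ l, x l * y l b = c * z) ∧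
        (¬ (i < j ∧ j ∈ S) → x = 0) := by
      intro j
      by_cases h : i < j ∧ j ∈ S
      · obtain ⟨x, h1, h2, h3⟩ := ih j h.1 h.2
        exact ⟨x, h1, fun _ => h2, fun _ _ => h3, fun h' => absurd h h'⟩
      · exact ⟨0, fun l => zero_mem _, fun _ _ _ => rfl, fun h1 h2 => absurd ⟨h1, h2⟩ h,
          fun _ => rfl⟩
    choose X hX hX0 hXz hXn using this
    refine ⟨fun l => (if i < l ∧ l ∉ S then w i l else 0) - ∑ j, w i j * X j l, ?_, ?_, ?_⟩
    · intro l
      refine sub_mem ?_ (sum_mem fun j _ => mul_mem (hw i j) (hX j l))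
      split_ifs
      · exact hw i l
      · exact zero_mem _
    · intro l hl
      beta_reduce
      rw [if_neg hl, zero_sub, neg_eq_zero]
      refine Finset.sum_eq_zero fun j _ => ?_
      by_cases h : i < j ∧ j ∈ S
      · rw [hX0 j h.1 l fun h' => hl ⟨h.1.trans h'.1, h'.2⟩, mul_zero]
      · rw [hXn j h]; simp
    · intro b
      obtain ⟨z, hz, hwz⟩ := hwy i b
      have hzz : ∀ j, ∃ z ∈ 𝒪[F], (if i < j ∧ j ∈ S then
          y j b + ∑ l, X j l * y l b else 0) = c * z := by
        intro j
        split_ifs with h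
        · exact hXz j h.1 h.2 b
        · exact ⟨0, zero_mem _, by simp⟩
      choose Z hZ hZe using hzz
      refine ⟨z - ∑ j, w i j * Z j, sub_mem hz (sum_mem fun j _ => mul_mem (hw i j) (hZ j)), ?_⟩
      have e1 : (w * y) i b = y i b + ∑ j, (if i < j ∧ j ∉ S then w i j else 0) * y j b +
          ∑ j, (if i < j ∧ j ∈ S then w i j else 0) * y j b := by
        rw [mul_apply, add_assoc, ← Finset.sum_add_distrib]
        have : y i b = ∑ j, (if j = i then 1 else 0) * y j b := by simp
        rw [this, ← Finset.sum_add_distrib]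
        refine Finset.sum_congr rfl fun j _ => ?_
        rcases lt_trichotomy i j with h | rfl | h
        · by_cases hS : j ∈ S <;> simp [h, h.ne', hS]
        · simp [hw1 i hi]
        · simp [h.not_gt, h.ne, hw0 i j h]
      have e2 : c * ∑ j, w i j * Z j = ∑ j, (if i < j ∧ j ∈ S then w i j else 0) * y j b +
          ∑ l, (∑ j, w i j * X j l) * y l b := by
        simp_rw [Finset.sum_mul]
        rw [Finset.sum_comm, ← Finset.sum_add_distrib, Finset.mul_sum]
        refine Finset.sum_congr rfl fun j _ => ?_
        rw [mul_left_comm, ← hZe j]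
        split_ifs with h
        · rw [mul_add, Finset.mul_sum]
          congr 1
          exact Finset.sum_congr rfl fun l _ => by ring
        · simp [hXn j h]
      rw [mul_sub, ← hwz, e1, e2]
      simp_rw [sub_mul, Finset.sum_sub_distrib]
      ring

end ValuedGroups

/-! ### Left cosets in the minuscule double cosets. -/

section Cosets

variable {F : Type*} [Field F] [ValuativeRel F] [IsDiscreteValuationRing 𝒪[F]] {n : ℕ}
  {ϖ : 𝒪[F]} {t : Fˣ}

/-- A lift of an element of the residue field. -/
noncomputable def residueLift (x : 𝓀[F]) : 𝒪[F] :=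
  Function.surjInv (IsLocalRing.residue_surjective (R := 𝒪[F])) x

theorem residue_residueLift (x : 𝓀[F]) : IsLocalRing.residue 𝒪[F] (residueLift x) = x :=
  Function.surjInv_eq _ x

theorem residue_eq_iff (hϖ : Irreducible ϖ) (x y : 𝒪[F]) :
    IsLocalRing.residue 𝒪[F] x = IsLocalRing.residue 𝒪[F] y ↔
      ∃ z ∈ 𝒪[F], (x : F) - y = ϖ * z := by
  rw [← sub_eq_zero, ← map_sub, IsLocalRing.residue_eq_zero_iff, hϖ.maximalIdeal_eq, Ideal.mem_span_singleton]
  constructor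
  · rintro ⟨z, hz⟩
    exact ⟨z, z.2, by have := congrArg (Subtype.val) hz; simpa using this⟩
  · rintro ⟨z, hz, h⟩
    exact ⟨⟨z, hz⟩, Subtype.ext (by simpa using h)⟩

/-- Representatives of the cosets `xK` in the double cosets of minuscule diagonal matrices. -/
noncomputable def repGL (t : Fˣ) (S : Finset (Fin n)) (x : Inv S → 𝓀[F]) : GL (Fin n) F :=
  invGL S (fun p => (residueLift (x p) : F)) * torus t (ind S)

/-- Both y = uϖ^a and ϖy⁻¹ are integral on this double coset, so the exponents are 0 or 1, and the
determinant fixes the number of ones. The relations between the rows of y modulo ϖ then supply the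
residues labelling its coset. -/
theorem exists_repGL (hϖ : Irreducible ϖ) (ht : (t : F) = ϖ) {S₀ : Finset (Fin n)}
    {u k₁ k₂ : GL (Fin n) F} (hu : u ∈ upperUnipotent) {a : Fin n → ℤ}
    (hk₁ : k₁ ∈ maxCompact F n) (hk₂ : k₂ ∈ maxCompact F n)
    (h : u * torus t a = k₁ * torus t (ind S₀) * k₂) :
    ∃ S : Finset (Fin n), S.card = S₀.card ∧ a = ind S ∧
      ∃ x : Inv S → 𝓀[F], (repGL t S x)⁻¹ * (u * torus t a) ∈ maxCompact F n := by
  have hlt := valuation_uniformizer_lt_one hϖ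
  have h01 : ∀ i, 0 ≤ ind S₀ i ∧ ind S₀ i ≤ 1 := fun i => by unfold ind; split_ifs <;> simp
  set y := u * torus t a with hy
  set w := torus t (fun _ => 1) * y⁻¹ with hw
  have hyint : ∀ i j, y.1 i j ∈ 𝒪[F] := by
    rw [h]
    exact mul_integral (mul_integral (mem_maxCompact_iff.1 hk₁).1
      (torus_entries_integral hϖ ht fun i => (h01 i).1)) (mem_maxCompact_iff.1 hk₂).1
  have hwint : ∀ i j, w.1 i j ∈ 𝒪[F] := by
    have e : w = k₂⁻¹ * torus t ((fun _ => 1) + -ind S₀) * k₁⁻¹ := by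
      rw [hw, h, torus_add, torus_neg, _root_.mul_inv_rev, _root_.mul_inv_rev,
        ← mul_assoc k₂⁻¹ (torus t _), ← torus_const_comm]
      group
    rw [e]
    exact mul_integral (mul_integral (mem_maxCompact_iff.1 hk₂).2
      (torus_entries_integral hϖ ht fun i => by simpa using (h01 i).2))
      (mem_maxCompact_iff.1 hk₁).2
  have hwapp : ∀ i j, w.1 i j = ((t ^ (1 - a i) : Fˣ) : F) * (u⁻¹).1 i j := by
    intro i j
    have e : w = torus t ((fun _ => 1) + -a) * u⁻¹ := by
      rw [hw, hy, torus_add, torus_neg]; group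
    rw [e, torus_mul_apply]
    rfl
  have hu' := inv_mem hu
  have ha0 : ∀ i, 0 ≤ a i := by
    intro i
    have := hyint i i
    rwa [hy, mul_torus_apply, hu.1 i, one_mul, zpow_mem_integer_iff hϖ ht] at this
  have ha1 : ∀ i, a i ≤ 1 := by
    intro i
    have := hwint i i
    rw [hwapp, hu'.1 i, mul_one, zpow_mem_integer_iff hϖ ht] at this
    linarith
  obtain ⟨S, rfl⟩ : ∃ S : Finset (Fin n), a = ind S := by
    refine ⟨Finset.univ.filter fun i => a i = 1, funext fun i => ?_⟩
    have := ha0 i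
    have := ha1 i
    simp only [ind, Finset.mem_filter, Finset.mem_univ, true_and]
    split_ifs <;> omega
  have hv0 : 0 < ValuativeRel.valuation F (t : F) := by simp [zero_lt_iff]
  refine ⟨S, ?_, rfl, ?_⟩
  · have e := congrArg (fun g : GL (Fin n) F => ValuativeRel.valuation F g.1.det) h
    simp only [hy, Units.val_mul, det_mul, map_mul, valuation_det_of_mem hk₁,
      valuation_det_of_mem hk₂, det_torus, sum_ind] at e
    rw [det_of_isUpperTriangular (fun i j h => hu.2 i j h)] at e
    simp only [hu.1, Finset.prod_const_one, map_one, one_mul, mul_one, zpow_natCast,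
      Units.val_pow_eq_pow_val, map_pow] at e
    exact pow_right_injective₀ hv0 (by rw [ht]; exact hlt.ne) e
  · have hrel := exists_row_relation (y := y.1) (c := (t : F)) (S := S) hwint
      (fun i j hij => by rw [hwapp, hu'.2 i j hij, mul_zero])
      (fun i hi => by rw [hwapp, hu'.1 i]; simp [ind, hi]) (fun i b => by
        refine ⟨(1 : Matrix (Fin n) (Fin n) F) i b, ?_, ?_⟩
        · rw [one_apply]; split_ifs
          · exact one_mem _
          · exact zero_mem _
        · rw [← Units.val_mul, hw, inv_mul_cancel_right, torus, coe_diagGL, diagonal_apply,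
            one_apply]
          split_ifs <;> simp)
    choose! X hX hX0 hXz using hrel
    -- The sign is chosen so that left multiplication by the inverse unipotent `v⁻¹` adds the
    -- multiples `X`, making the rows in `S` divisible by ϖ.
    let r : Inv S → 𝒪[F] := fun p => ⟨-X p.1.1 p.1.2, neg_mem (hX _ p.2.2.1 _)⟩
    let x : Inv S → 𝓀[F] := fun p => IsLocalRing.residue 𝒪[F] (r p)
    refine ⟨x, ?_⟩
    have hdiff : ∀ p, ∃ z ∈ 𝒪[F], (r p : F) - (residueLift (x p) : F) = t * z := by
      intro p
      rw [ht, ← residue_eq_iff hϖ, residue_residueLift]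
    set v := invGL S (fun p => (residueLift (x p) : F)) with hv
    have hvN : v ∈ upperUnipotent := invGL_mem_upperUnipotent _ _
    have e : (repGL t S x)⁻¹ * y = (torus t (ind S))⁻¹ * (v⁻¹ * u) * torus t (ind S) := by
      rw [repGL, hy, ← hv]; group
    have hmem : (repGL t S x)⁻¹ * y ∈ upperUnipotent := by
      rw [e]
      exact torus_conj_mem' _ _ (mul_mem (inv_mem hvN) hu)
    refine unipotent_mem_maxCompact hmem fun i b _ => ?_
    have e2 : (repGL t S x)⁻¹ * y = torus t (-ind S) * (v⁻¹ * y) := by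
      rw [repGL, torus_neg, ← hv]; group
    have hvapp : (v⁻¹ * y).1 i b =
        y.1 i b - ∑ j, invMatrix S (fun p => (residueLift (x p) : F)) i j * y.1 j b := by
      rw [Units.val_mul, hv, invGL, coe_oneAddGL_inv, Matrix.sub_mul, Matrix.one_mul, Matrix.sub_apply,
        mul_apply]
    rw [e2, torus_mul_apply, hvapp]
    by_cases hi : i ∈ S
    · obtain ⟨z, hz, hzeq⟩ := hXz i hi b
      have hj : ∀ j, ∃ z ∈ 𝒪[F],
          invMatrix S (fun p => (residueLift (x p) : F)) i j + X i j = t * z := by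
        intro j
        by_cases hij : i < j ∧ i ∈ S ∧ j ∉ S
        · obtain ⟨z, hz, h⟩ := hdiff ⟨(i, j), hij⟩
          refine ⟨-z, neg_mem hz, ?_⟩
          rw [invMatrix, dif_pos hij, mul_neg, ← h]
          simp only [r]
          ring
        · rw [invMatrix_apply_of_not _ hij, hX0 i hi j (fun h => hij ⟨h.1, hi, h.2⟩)]
          exact ⟨0, zero_mem _, by simp⟩
      choose Z hZ hZe using hj
      have hfin : y.1 i b - ∑ j, invMatrix S (fun p => (residueLift (x p) : F)) i j * y.1 j b =
          t * (z - ∑ j, Z j * y.1 j b) := by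
        have : ∀ j, invMatrix S (fun p => (residueLift (x p) : F)) i j = t * Z j - X i j :=
          fun j => by rw [← hZe]; ring
        simp_rw [this, sub_mul, Finset.sum_sub_distrib, mul_sub, ← hzeq, Finset.mul_sum, mul_assoc]
        ring
      rw [hfin]
      simp only [Pi.neg_apply, ind, hi, if_true, _root_.zpow_neg, zpow_one, Units.val_inv_eq_inv_val]
      rw [inv_mul_cancel_left₀ t.ne_zero]
      exact sub_mem hz (sum_mem fun j _ => mul_mem (hZ j) (hyint j b))
    · simp only [Pi.neg_apply, ind, hi, if_false, neg_zero, zpow_zero, Units.val_one, one_mul]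
      rw [Finset.sum_eq_zero fun j _ => by rw [invMatrix_apply_of_not _ (fun h => hi h.2.1),
        zero_mul], sub_zero]
      exact hyint i b

/-- At a position of `Inv S` the product has entry ϖ⁻¹ times the difference of the two lifts;
integrality makes the residues agree. -/
theorem repGL_coset_injective (hϖ : Irreducible ϖ) (ht : (t : F) = ϖ) {S : Finset (Fin n)}
    {x y : Inv S → 𝓀[F]} (h : (repGL t S x)⁻¹ * repGL t S y ∈ maxCompact F n) : x = y := by
  ext ⟨⟨i, j⟩, hij⟩
  have h1 := (mem_maxCompact_iff.1 h).1 i j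
  have e : (repGL t S x)⁻¹ * repGL t S y = torus t (-ind S) *
      (((invGL S (fun p => (residueLift (x p) : F)))⁻¹ * invGL S (fun p => (residueLift (y p) : F)))
        * torus t (ind S)) := by
    rw [repGL, repGL, torus_neg]; group
  rw [e, torus_mul_apply, mul_torus_apply, Units.val_mul, invGL, invGL, coe_oneAddGL_inv,
    coe_oneAddGL, Matrix.mul_add, Matrix.mul_one, Matrix.sub_mul, invMatrix_mul, Matrix.one_mul,
    sub_zero] at h1
  simp only [Pi.neg_apply, ind, hij.2.1, hij.2.2, if_true, if_false, Matrix.add_apply,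
    Matrix.sub_apply, one_apply_ne hij.1.ne, invMatrix, hij.1, not_false_eq_true, and_self, dif_pos, _root_.zpow_neg, zpow_one, zpow_zero,
    Units.val_inv_eq_inv_val, Units.val_one, mul_one, zero_sub] at h1
  rw [← residue_residueLift (x ⟨(i, j), hij⟩), ← residue_residueLift (y ⟨(i, j), hij⟩), eq_comm,
    residue_eq_iff hϖ]
  refine ⟨_, h1, ?_⟩
  rw [← ht, mul_inv_cancel_left₀ t.ne_zero]
  ring

/-- A permutation matrix in K carries one diagonal matrix to the other, and the unipotent factor is
also in K. -/
theorem repGL_mem_orbit {S S₀ : Finset (Fin n)} (hS : S.card = S₀.card) (x : Inv S → 𝓀[F]) :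
    ((repGL t S x : GL (Fin n) F) : GL (Fin n) F ⧸ maxCompact F n) ∈
      MulAction.orbit (maxCompact F n) (torus t (ind S₀) : GL (Fin n) F ⧸ maxCompact F n) := by
  obtain ⟨σ, hσ⟩ := exists_perm_ind hS
  have hv : invGL S (fun p => (residueLift (x p) : F)) ∈ maxCompact F n :=
    invGL_mem_maxCompact fun p => (residueLift (x p)).2
  refine ⟨⟨_, mul_mem hv (permGL_mem_maxCompact σ)⟩, ?_⟩
  change (((invGL S (fun p => (residueLift (x p) : F)) * permGL σ) * torus t (ind S₀) :
    GL (Fin n) F) : GL (Fin n) F ⧸ maxCompact F n) = _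
  have e : torus t (ind S) * permGL σ = permGL σ * torus t (ind S₀) := by
    rw [← hσ]
    exact permGL_conj_diagGL σ _
  rw [mul_assoc, ← e, ← mul_assoc]
  exact QuotientGroup.mk_mul_of_mem _ (permGL_mem_maxCompact σ)

/-- The cosets in the double coset of `torus t (ind S₀)`. -/
theorem orbit_eq_range (hϖ : Irreducible ϖ) (ht : (t : F) = ϖ) (S₀ : Finset (Fin n)) :
    MulAction.orbit (maxCompact F n) (torus t (ind S₀) : GL (Fin n) F ⧸ maxCompact F n) =
      Set.range fun p : Σ S : {S : Finset (Fin n) // S.card = S₀.card}, Inv S.1 → 𝓀[F] =>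
        ((repGL t p.1.1 p.2 : GL (Fin n) F) : GL (Fin n) F ⧸ maxCompact F n) := by
  refine Set.Subset.antisymm ?_ ?_
  · rintro _ ⟨⟨k, hk⟩, rfl⟩
    obtain ⟨u, hu, a, k', hk', h⟩ := exists_iwasawa hϖ ht (k * torus t (ind S₀))
    obtain ⟨S, hS, rfl, x, hx⟩ := exists_repGL hϖ ht hu hk (inv_mem hk')
      (show u * torus t a = k * torus t (ind S₀) * k'⁻¹ by rw [h]; group)
    refine ⟨⟨⟨S, hS⟩, x⟩, ?_⟩
    change _ = ((k * torus t (ind S₀) : GL (Fin n) F) : GL (Fin n) F ⧸ maxCompact F n)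
    rw [QuotientGroup.eq, h, ← mul_assoc]
    exact mul_mem hx hk'
  · rintro _ ⟨⟨⟨S, hS⟩, x⟩, rfl⟩
    exact repGL_mem_orbit hS x

theorem repGL_injective (hϖ : Irreducible ϖ) (ht : (t : F) = ϖ) (r : ℕ) :
    Function.Injective fun p : Σ S : {S : Finset (Fin n) // S.card = r}, Inv S.1 → 𝓀[F] =>
      ((repGL t p.1.1 p.2 : GL (Fin n) F) : GL (Fin n) F ⧸ maxCompact F n) := by
  rintro ⟨⟨S, hS⟩, x⟩ ⟨⟨T, hT⟩, y⟩ h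
  simp only [QuotientGroup.eq] at h
  obtain rfl := ind_injective (torus_exponent_unique hϖ ht (invGL_mem_upperUnipotent _ _)
    (invGL_mem_upperUnipotent _ _) h)
  rw [repGL_coset_injective hϖ ht h]

end Cosets

/-! ### Finiteness of the set of left cosets in a double coset. -/

section FiniteOrbits

variable {F : Type*} [Field F] [ValuativeRel F] [IsDiscreteValuationRing 𝒪[F]] {n : ℕ}
  {ϖ : 𝒪[F]}

theorem exists_pow_mul_integral (hϖ : Irreducible ϖ) (x : F) :
    ∃ m : ℕ, ∀ M ≥ m, (ϖ : F) ^ M * x ∈ 𝒪[F] := by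
  rcases eq_or_ne x 0 with rfl | hx
  · exact ⟨0, fun M _ => by rw [mul_zero]; exact zero_mem _⟩
  obtain ⟨a, e, he, rfl⟩ := exists_zpow_mul_unit hϖ hx
  have h0 : (ϖ : F) ≠ 0 := fun h => hϖ.ne_zero (Subtype.ext h)
  refine ⟨(-a).toNat, fun M hM => ?_⟩
  rw [← mul_assoc, ← zpow_natCast, ← zpow_add₀ h0]
  refine mul_mem ?_ he.le
  have := (zpow_mem_integer_iff hϖ (t := Units.mk0 _ h0) rfl (a := (M : ℤ) + a)).2 (by omega)
  simpa using this

theorem exists_pow_mul_matrix_integral (hϖ : Irreducible ϖ) (A : Matrix (Fin n) (Fin n) F) :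
    ∃ m : ℕ, ∀ M ≥ m, ∀ i j, (ϖ : F) ^ M * A i j ∈ 𝒪[F] := by
  choose m hm using fun p : Fin n × Fin n => exists_pow_mul_integral hϖ (A p.1 p.2)
  obtain ⟨M, hM⟩ := (Set.finite_range m).bddAbove
  exact ⟨M, fun M' h i j => hm (i, j) M' ((hM ⟨(i, j), rfl⟩).trans h)⟩

/-- A double coset `KgK` consists of finitely many cosets `xK`. -/
theorem finite_orbit [Finite 𝓀[F]] (hϖ : Irreducible ϖ) (g : GL (Fin n) F) :
    (MulAction.orbit (maxCompact F n) (g : GL (Fin n) F ⧸ maxCompact F n)).Finite := by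
  obtain ⟨m₁, h₁⟩ := exists_pow_mul_matrix_integral hϖ g.1
  obtain ⟨m₂, h₂⟩ := exists_pow_mul_matrix_integral hϖ (g⁻¹).1
  let M := max m₁ m₂
  have hM₁ := h₁ M (le_max_left _ _)
  have hM₂ := h₂ M (le_max_right _ _)
  -- If k and k' agree modulo ϖ^(2M), one factor ϖ^M clears the denominators of g and the other
  -- those of g⁻¹, so kg and k'g define the same coset.
  let I : Ideal 𝒪[F] := IsLocalRing.maximalIdeal 𝒪[F] ^ (M + M)
  have : Finite (𝒪[F] ⧸ IsLocalRing.maximalIdeal 𝒪[F]) := inferInstanceAs (Finite 𝓀[F])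
  have hfin : Finite (𝒪[F] ⧸ I) := Ideal.finite_quotient_pow (IsNoetherian.noetherian _) _
  have hint : ∀ k : maxCompact F n, ∀ i j, (k : GL (Fin n) F).1 i j ∈ 𝒪[F] :=
    fun k => (mem_maxCompact_iff.1 k.2).1
  let φ : maxCompact F n → Fin n → Fin n → 𝒪[F] ⧸ I :=
    fun k i j => Ideal.Quotient.mk I ⟨_, hint k i j⟩
  let f : maxCompact F n → GL (Fin n) F ⧸ maxCompact F n :=
    fun k => k • (g : GL (Fin n) F ⧸ maxCompact F n)
  have key : ∀ k k' : maxCompact F n, φ k = φ k' → ∀ i j,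
      ((((k : GL (Fin n) F) * g)⁻¹ * (k' * g) : GL (Fin n) F) : Matrix (Fin n) (Fin n) F) i j ∈
        𝒪[F] := by
    intro k k' h i j
    have hX : ∀ i j, ∃ z ∈ 𝒪[F], k'.1.1 i j - k.1.1 i j = (ϖ : F) ^ (M + M) * z := by
      intro i j
      have := congrFun (congrFun h i) j
      rw [eq_comm, Ideal.Quotient.eq] at this
      change _ ∈ IsLocalRing.maximalIdeal 𝒪[F] ^ (M + M) at this
      rw [hϖ.maximalIdeal_eq, Ideal.span_singleton_pow,
        Ideal.mem_span_singleton] at this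
      obtain ⟨z, hz⟩ := this
      exact ⟨z, z.2, by simpa using congrArg Subtype.val hz⟩
    choose X hXi hX using hX
    have e : (((k : GL (Fin n) F) * g)⁻¹ * (k' * g)).1 =
        1 + ((ϖ : F) ^ M • (g⁻¹).1) * (((k : GL (Fin n) F)⁻¹).1 * (of X * ((ϖ : F) ^ M • g.1))) := by
      have h1 : k'.1.1 = k.1.1 + (ϖ : F) ^ (M + M) • of X := by
        ext a b
        rw [Matrix.add_apply, Matrix.smul_apply, of_apply, smul_eq_mul, ← hX]
        ring
      rw [_root_.mul_inv_rev, Units.val_mul, Units.val_mul, Units.val_mul, h1, Matrix.add_mul,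
        Matrix.mul_add, mul_assoc (g⁻¹).1, ← mul_assoc (k.1⁻¹).1, ← Units.val_mul (k.1⁻¹),
        inv_mul_cancel, Units.val_one, Matrix.one_mul, ← Units.val_mul (g⁻¹), inv_mul_cancel,
        Units.val_one]
      simp only [smul_mul_assoc, mul_smul_comm, smul_smul, mul_assoc, pow_add]
    rw [e, Matrix.add_apply]
    refine add_mem ?_ (mul_integral (fun a b => hM₂ a b) (mul_integral
      (mem_maxCompact_iff.1 k.2).2 (mul_integral hXi fun a b => hM₁ a b)) i j)
    rw [one_apply]
    split_ifs
    · exact one_mem _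
    · exact zero_mem _
  have hf : Function.FactorsThrough f φ := by
    intro k k' h
    change ((k * g : GL (Fin n) F) : GL (Fin n) F ⧸ maxCompact F n) = (k' * g : GL (Fin n) F)
    rw [QuotientGroup.eq]
    refine mem_maxCompact_iff.2 ⟨key k k' h, ?_⟩
    rw [_root_.mul_inv_rev, inv_inv]
    exact key k' k h.symm
  have hsub : MulAction.orbit (maxCompact F n) (g : GL (Fin n) F ⧸ maxCompact F n) ⊆
      Set.range (Function.extend φ f fun _ => (g : GL (Fin n) F ⧸ maxCompact F n)) := by
    rintro _ ⟨k, rfl⟩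
    exact ⟨φ k, hf.extend_apply _ k⟩
  exact (Set.finite_range _).subset hsub

end FiniteOrbits

/-! ### One-dimensionality of the fixed vectors, by averaging. -/

section Abstract

variable {k G V : Type*} [Field k] [Group G] [AddCommGroup V] [Module k V]
  {ρ : Representation k G V}

theorem eq_bot_or_eq_top_of_stable (hρ : ρ.IsIrreducible) (W : Submodule k V)
    (hW : ∀ g, ∀ v ∈ W, ρ g v ∈ W) : W = ⊥ ∨ W = ⊤ := by
  rcases hρ.eq_bot_or_eq_top ⟨W, fun g v hv => hW g v hv⟩ with h | h
  · exact Or.inl (congrArg Subrepresentation.toSubmodule h)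
  · exact Or.inr (congrArg Subrepresentation.toSubmodule h)

theorem span_translates_eq_top (hρ : ρ.IsIrreducible) {v : V} (hv : v ≠ 0) :
    Submodule.span k (Set.range fun g => ρ g v) = ⊤ := by
  refine (eq_bot_or_eq_top_of_stable hρ _ ?_).resolve_left ?_
  · intro g w hw
    induction hw using Submodule.span_induction with
    | mem x hx =>
      obtain ⟨h, rfl⟩ := hx
      exact Submodule.subset_span ⟨g * h, by simp⟩
    | zero => simp
    | add x y _ _ hx hy => rw [map_add]; exact add_mem hx hy
    | smul a x _ hx => rw [map_smul]; exact Submodule.smul_mem _ a hx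
  · intro h
    rw [Submodule.span_eq_bot] at h
    exact hv (by simpa using h _ ⟨1, rfl⟩)

theorem apply_eq_of_coset_eq {K : Subgroup G} {v : V} (hv : ∀ k ∈ K, ρ k v = v) {g h : G}
    (e : (g : G ⧸ K) = h) : ρ g v = ρ h v := by
  rw [show h = g * (g⁻¹ * h) by group, map_mul, Module.End.mul_apply,
    hv _ (QuotientGroup.eq.1 e)]

/-- If a non-zero `K`-fixed vector is an eigenvector of all Hecke operators, then the space of
`K`-fixed vectors is a line. -/
theorem mem_span_of_fixed [CharZero k] (hρ : ρ.IsIrreducible) {K : Subgroup G}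
    (hfin : ∀ g : G, (MulAction.orbit K (g : G ⧸ K)).Finite) {v : V} (hv0 : v ≠ 0)
    (hv : ∀ g ∈ K, ρ g v = v)
    (hT : ∀ g : G, ∑ᶠ c ∈ MulAction.orbit K (g : G ⧸ K), ρ c.out v ∈ Submodule.span k {v})
    {w : V} (hw : ∀ g ∈ K, ρ g w = w) : w ∈ Submodule.span k {v} := by
  have hwtop : w ∈ Submodule.span k (Set.range fun g => ρ g v) := by
    rw [span_translates_eq_top hρ hv0]; trivial
  obtain ⟨c, rfl⟩ := Finsupp.mem_span_range_iff_exists_finsupp.1 hwtop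
  have hidx : ∀ g : G, (MulAction.stabilizer K (g : G ⧸ K)).FiniteIndex := by
    intro g
    refine ⟨?_⟩
    rw [MulAction.index_stabilizer]
    exact ((Set.ncard_pos (hfin g)).2 (MulAction.nonempty_orbit _)).ne'
  -- Only finitely many translates of v occur in w, so a subgroup of finite index in K fixes all of
  -- them. Its normal core makes right translation act on the quotient.
  let H₀ : Subgroup K := ⨅ g : c.support, MulAction.stabilizer K ((g : G) : G ⧸ K)
  have : H₀.FiniteIndex := Subgroup.finiteIndex_iInf fun g => hidx g
  let H := H₀.normalCore
  have : Fintype (K ⧸ H) := Fintype.ofFinite _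
  have hH : ∀ g ∈ c.support, ∀ h ∈ H, ρ (h : K) (ρ g v) = ρ g v := by
    intro g hg h hh
    have h1 : h ∈ MulAction.stabilizer K (g : G ⧸ K) :=
      (Subgroup.mem_iInf.1 (Subgroup.normalCore_le _ hh)) ⟨g, hg⟩
    rw [← Module.End.mul_apply, ← map_mul]
    exact apply_eq_of_coset_eq hv h1
  -- The unnormalized average over K/H. On vectors fixed by H it does not depend on the chosen
  -- representatives.
  let E : V →ₗ[k] V := ∑ q : K ⧸ H, ρ (q.out : K)
  have hE : ∀ x : V, E x = ∑ q : K ⧸ H, ρ (q.out : K) x := fun x => by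
    simp [E, LinearMap.sum_apply]
  have hEfix : ∀ x : V, (∀ g ∈ K, ρ g x = x) → E x = (Fintype.card (K ⧸ H) : k) • x := by
    intro x hx
    rw [hE, Finset.sum_congr rfl fun q _ => hx _ (q.out : K).2]
    simp [Nat.cast_smul_eq_nsmul]
  have hEinv : ∀ x : V, (∀ h ∈ H, ρ (h : K) x = x) → ∀ g : K, E (ρ g x) = E x := by
    intro x hx g
    rw [hE, hE, ← Equiv.sum_comp (Equiv.mulRight (g : K ⧸ H)) fun q => ρ (q.out : K) x]
    refine Finset.sum_congr rfl fun q _ => ?_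
    have h1 : (((Equiv.mulRight (g : K ⧸ H)) q).out)⁻¹ * (q.out * g) ∈ H := by
      rw [← QuotientGroup.eq, QuotientGroup.mk_mul, QuotientGroup.out_eq', QuotientGroup.out_eq']
      rfl
    have h2 := hx _ h1
    rw [Subgroup.coe_mul, map_mul, Module.End.mul_apply, Subgroup.coe_mul, map_mul,
      Module.End.mul_apply] at h2
    have h3 := congrArg (ρ ((Equiv.mulRight (g : K ⧸ H)) q).out) h2
    rw [← Module.End.mul_apply, ← map_mul, ← Subgroup.coe_mul, mul_inv_cancel] at h3
    simpa using h3
  -- The Hecke sum at g consists of K-translates of ρ(g)v, all with the same average, so E(ρ(g)v) is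
  -- a non-zero scalar times the average of that sum. The latter is already K-fixed and lies on the
  -- line of v.
  have hEg : ∀ g ∈ c.support, E (ρ g v) ∈ Submodule.span k {v} := by
    intro g hg
    have hTg := hT g
    rw [finsum_mem_eq_finite_toFinset_sum _ (hfin g)] at hTg
    have h1 : E (∑ c ∈ (hfin g).toFinset, ρ c.out v) ∈ Submodule.span k {v} := by
      obtain ⟨a, ha⟩ := Submodule.mem_span_singleton.1 hTg
      rw [hEfix _ fun x hx => by rw [← ha, map_smul, hv x hx]]
      exact Submodule.smul_mem _ _ hTg
    rw [map_sum, Finset.sum_congr rfl (g := fun _ => E (ρ g v))] at h1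
    · rw [Finset.sum_const, ← Nat.cast_smul_eq_nsmul k] at h1
      refine (Submodule.smul_mem_iff _ ?_).1 h1
      rw [Nat.cast_ne_zero, Finset.card_ne_zero, Set.Finite.toFinset_nonempty]
      exact MulAction.nonempty_orbit _
    · intro d hd
      rw [Set.Finite.mem_toFinset] at hd
      obtain ⟨x, rfl⟩ := hd
      rw [← hEinv (ρ g v) (hH g hg) x, ← Module.End.mul_apply (ρ (x : G)), ← map_mul]
      refine congrArg E (apply_eq_of_coset_eq hv ?_)
      rw [QuotientGroup.out_eq']
      rfl
  have hfinal := hEfix _ hw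
  rw [← Submodule.smul_mem_iff _ (s := (Fintype.card (K ⧸ H) : k))
    (Nat.cast_ne_zero.2 Fintype.card_ne_zero), ← hfinal, Finsupp.sum, map_sum]
  refine sum_mem fun g hg => ?_
  rw [map_smul]
  exact Submodule.smul_mem _ _ (hEg g hg)

end Abstract

/-! ### The recursion on weights. -/

section Combinatorics

variable {n : ℕ}

theorem ind_univ : ind (Finset.univ : Finset (Fin n)) = fun _ => 1 := by
  ext i; simp [ind]

instance : IsEmpty (Inv (Finset.univ : Finset (Fin n))) := ⟨fun p => p.2.2.2 (Finset.mem_univ _)⟩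

/-- This makes q^|Inv S| δ^{1/2} depend only on the size of S, so that a Satake transform becomes a
multiple of an elementary symmetric polynomial. It is a count of the pairs i < j with i in S, using
that the ordered pairs inside S are symmetric. -/
theorem card_inv_formula (S : Finset (Fin n)) :
    2 * (Fintype.card (Inv S) : ℤ) + ∑ j, ind S j * (2 * ((j : ℕ) : ℤ) + 1 - n) =
      S.card * (n - S.card) := by
  have h1 : Fintype.card (Inv S) = ∑ i ∈ S, (Finset.univ.filter fun j => i < j ∧ j ∉ S).card := by
    rw [Fintype.card_subtype, ← Finset.card_sigma]
    refine Finset.card_bij' (fun p _ => ⟨p.1, p.2⟩) (fun p _ => (p.1, p.2)) ?_ ?_ ?_ ?_ <;>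
      simp +contextual
  have h2 : ∀ i : Fin n, (Finset.univ.filter fun j => i < j ∧ j ∉ S).card +
      (S.filter fun j => i < j).card = n - 1 - i := by
    intro i
    rw [← Fin.card_Ioi, ← Finset.card_filter_add_card_filter_not (s := Finset.Ioi i) (· ∉ S)]
    congr 2
    · ext j; simp
    · ext j; simp [and_comm]
  have h3 : 2 * ∑ i ∈ S, (S.filter fun j => i < j).card + S.card = S.card * S.card := by
    have e1 : ∑ i ∈ S, (S.filter fun j => i < j).card = ∑ i ∈ S, (S.filter fun j => j < i).card := by
      simp_rw [Finset.card_filter]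
      exact Finset.sum_comm
    have e2 : ∀ i ∈ S, (S.filter fun j => i < j).card + (S.filter fun j => j < i).card + 1 =
        S.card := by
      intro i hi
      rw [← Finset.card_union_of_disjoint, ← Finset.card_erase_add_one hi]
      · congr 2
        ext j
        simp only [Finset.mem_union, Finset.mem_filter, Finset.mem_erase, ← and_or_left, lt_or_lt_iff_ne]
        rw [and_comm, ne_comm]
      · refine Finset.disjoint_filter.2 fun j _ h => h.not_gt
    rw [two_mul]
    nth_rw 2 [e1]
    rw [← Finset.sum_add_distrib, ← smul_eq_mul, ← Finset.sum_const, Finset.card_eq_sum_ones,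
      ← Finset.sum_add_distrib]
    exact Finset.sum_congr rfl fun i hi => by rw [e2 i hi, Finset.card_eq_sum_ones]
  have h4 : ∀ i : Fin n, ((Finset.univ.filter fun j => i < j ∧ j ∉ S).card : ℤ) =
      n - 1 - i - (S.filter fun j => i < j).card := by
    intro i
    have := h2 i
    have := i.2
    omega
  have h5 : ∑ j, ind S j * (2 * ((j : ℕ) : ℤ) + 1 - n) = ∑ j ∈ S, (2 * ((j : ℕ) : ℤ) + 1 - n) := by
    simp [ind, Finset.sum_ite_mem]
  rw [h5, h1]
  push_cast
  simp_rw [h4]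
  have h6 : (2 * ∑ i ∈ S, ((S.filter fun j => i < j).card : ℤ) + S.card) = S.card * S.card := by
    exact_mod_cast h3
  simp only [Finset.sum_sub_distrib, Finset.sum_add_distrib, ← Finset.mul_sum, Finset.sum_const,
    nsmul_eq_mul]
  linarith

/-- Subtract 1 from every positive entry of l and apply the relation there with r the number of
those entries. It can be solved for w(l), since q is a unit and the other dominant weights that
occur have the same sum but more positive entries. -/
theorem mem_of_hecke_recursion_nat {R X : Type*} [CommRing R] [AddCommGroup X] [Module R X]
    {N : Submodule R X} {w : (Fin n → ℤ) → X} {q : R} (hq : IsUnit q) {s : ℕ → R}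
    (hnd : ∀ l, ¬ Antitone l → w l ∈ N)
    (hrec : ∀ l, Antitone l → ∀ r ≤ n, ∑ S ∈ Finset.powersetCard r Finset.univ,
      q ^ Fintype.card (Inv S) • w (l + ind S) = s r • w l)
    (h0 : w 0 ∈ N) (l : Fin n → ℕ) : w (fun i => l i) ∈ N := by
  -- Lexicographic order encoded in one number: smaller sum first, then more positive entries. The
  -- factor n + 1 exceeds any value of the second term.
  induction h : (∑ i, l i) * (n + 1) + (n - (Finset.univ.filter fun i => 0 < l i).card) using
    Nat.strong_induction_on generalizing l with
  | _ d ih =>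
  subst h
  by_cases hl : Antitone l
  swap
  · exact hnd _ fun h => hl fun i j hij => (Nat.cast_le (α := ℤ)).1 (h hij)
  by_cases hl0 : l = 0
  · subst hl0; exact h0
  set S₀ : Finset (Fin n) := Finset.univ.filter fun i => 0 < l i with hS₀
  have hmem : ∀ i, i ∈ S₀ ↔ 0 < l i := by simp [hS₀]
  have hpos : 0 < S₀.card := by
    rw [Finset.card_pos]
    by_contra! he
    refine hl0 (funext fun i => ?_)
    have := (hmem i).not.1 (by simp [he])
    simpa using this
  let l' : Fin n → ℕ := fun i => l i - if i ∈ S₀ then 1 else 0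
  have hll' : ∀ i, l i = l' i + if i ∈ S₀ then 1 else 0 := by
    intro i
    simp only [l']
    split_ifs with h
    · have := (hmem i).1 h; omega
    · rfl
  have hl' : Antitone l' := by
    intro i j hij
    have := hl hij
    simp only [l', hmem]
    split_ifs <;> omega
  have hcast : ∀ S : Finset (Fin n), (fun i => (l' i : ℤ)) + ind S =
      fun i => ((l' i + if i ∈ S then 1 else 0 : ℕ) : ℤ) := by
    intro S
    ext i
    simp [ind]
  have hsum : ∀ S : Finset (Fin n), ∑ i, (l' i + if i ∈ S then 1 else 0) = ∑ i, l' i + S.card := by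
    intro S
    rw [Finset.sum_add_distrib]
    simp
  have hsum0 : ∑ i, l i = ∑ i, l' i + S₀.card := by
    rw [← hsum]; exact Finset.sum_congr rfl fun i _ => hll' i
  have hcle : ∀ S : Finset (Fin n), S.card ≤ n := fun S => S.card_le_univ.trans_eq (by simp)
  have hw' : w (fun i => l' i) ∈ N := by
    refine ih _ ?_ l' rfl
    rw [hsum0]
    have h1 := hcle S₀
    nlinarith [Nat.sub_le n (Finset.univ.filter fun i => 0 < l' i).card]
  have hterm : ∀ S ∈ Finset.powersetCard S₀.card (Finset.univ : Finset (Fin n)), S ≠ S₀ →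
      w ((fun i => (l' i : ℤ)) + ind S) ∈ N := by
    intro S hS hne
    rw [Finset.mem_powersetCard] at hS
    by_cases ha : Antitone ((fun i => (l' i : ℤ)) + ind S)
    swap
    · exact hnd _ ha
    rw [hcast] at ha ⊢
    refine ih _ ?_ _ rfl
    rw [hsum, hsum0, hS.2]
    -- Such an index becomes positive; dominance keeps every earlier entry positive, so the positive
    -- set strictly grows.
    obtain ⟨j, hjS, hj⟩ : ∃ j ∈ S, j ∉ S₀ := by
      by_contra! hsub
      exact hne (Finset.eq_of_subset_of_card_le hsub hS.2.ge)
    have hjpos : 0 < l' j + if j ∈ S then 1 else 0 := by simp [hjS]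
    have hss : S₀ ⊂ Finset.univ.filter fun i => 0 < l' i + if i ∈ S then 1 else 0 := by
      rw [Finset.ssubset_iff_of_subset]
      · exact ⟨j, by simpa using hjpos, hj⟩
      · intro i hi
        have hij : i ≤ j := by
          by_contra! hlt
          exact hj ((hmem j).2 (((hmem i).1 hi).trans_le (hl hlt.le)))
        have := ha hij
        simp only [Finset.mem_filter, Finset.mem_univ, true_and]
        exact hjpos.trans_le ((Nat.cast_le (α := ℤ)).1 this)
    have := Finset.card_lt_card hss
    have := hcle (Finset.univ.filter fun i => 0 < l' i + if i ∈ S then 1 else 0)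
    omega
  have hS₀mem : S₀ ∈ Finset.powersetCard S₀.card (Finset.univ : Finset (Fin n)) := by
    simp [Finset.mem_powersetCard]
  have hkey := hrec (fun i => l' i) (fun i j hij => (Nat.cast_le (α := ℤ)).2 (hl' hij)) S₀.card (hcle S₀)
  rw [← Finset.add_sum_erase _ _ hS₀mem] at hkey
  have hmain : q ^ Fintype.card (Inv S₀) • w ((fun i => (l' i : ℤ)) + ind S₀) ∈ N := by
    rw [eq_sub_of_add_eq hkey]
    refine sub_mem (N.smul_mem _ hw') (sum_mem fun S hS => N.smul_mem _ ?_)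
    rw [Finset.mem_erase] at hS
    exact hterm S hS.2 hS.1
  rw [hcast, show (fun i => ((l' i + if i ∈ S₀ then 1 else 0 : ℕ) : ℤ)) = fun i => (l i : ℤ) from
    funext fun i => by rw [← hll']] at hmain
  exact (N.smul_mem_iff_of_isUnit (hq.pow _)).1 hmain

/-- A function on `ℤⁿ` which is known on non-dominant weights and satisfies the recursion given by
the minuscule Hecke operators is determined by its value at `0`. -/
theorem mem_of_hecke_recursion {R X : Type*} [CommRing R] [AddCommGroup X] [Module R X]
    {N : Submodule R X} {w : (Fin n → ℤ) → X} {q : R} (hq : IsUnit q) {s : ℕ → R}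
    (hs : IsUnit (s n)) (hnd : ∀ l, ¬ Antitone l → w l ∈ N)
    (hrec : ∀ l, Antitone l → ∀ r ≤ n, ∑ S ∈ Finset.powersetCard r Finset.univ,
      q ^ Fintype.card (Inv S) • w (l + ind S) = s r • w l)
    (h0 : w 0 ∈ N) (l : Fin n → ℤ) : w l ∈ N := by
  -- The relation for r = n has a single term and moves l by a constant vector. As s n is a unit,
  -- this reduces to weights with non-negative entries.
  have hshift : ∀ m : ℕ, ∀ l : Fin n → ℤ, w (l + fun _ => (m : ℤ)) ∈ N → w l ∈ N := by
    intro m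
    induction m with
    | zero =>
      intro l h
      convert h using 2
      ext i; simp
    | succ m ih =>
      intro l h
      by_cases hl : Antitone l
      swap
      · exact hnd _ hl
      have h1 := hrec l hl n le_rfl
      have huniv : Finset.powersetCard n (Finset.univ : Finset (Fin n)) = {Finset.univ} := by
        simpa using Finset.powersetCard_self (Finset.univ : Finset (Fin n))
      rw [huniv, Finset.sum_singleton, Fintype.card_eq_zero, pow_zero, one_smul, ind_univ] at h1
      rw [← N.smul_mem_iff_of_isUnit hs, ← h1]
      refine ih _ ?_
      convert h using 2
      ext i
      simp only [Pi.add_apply]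
      push_cast
      ring
  obtain ⟨M, hM⟩ := (Set.finite_range fun i => (l i).natAbs).bddAbove
  refine hshift M l ?_
  have := mem_of_hecke_recursion_nat hq hnd hrec h0 fun i => (l i + M).toNat
  convert this using 2
  ext i
  have : (l i).natAbs ≤ M := hM ⟨i, rfl⟩
  simp only [Pi.add_apply]
  omega

end Combinatorics

/-! ### Elementary symmetric polynomials of the Satake parameter. -/

section Coefficients

variable {n ℓ : ℕ} [Fact ℓ.Prime]

/-- The elementary symmetric polynomial of degree `r` in `μ`. -/
noncomputable def esymm (μ : Fin n → (PadicAlgCl ℓ)ˣ) (r : ℕ) : PadicAlgCl ℓ :=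
  ∑ S ∈ Finset.powersetCard r Finset.univ, ∏ j ∈ S, (μ j : PadicAlgCl ℓ)

theorem satakePoly_coeff (μ : Fin n → (PadicAlgCl ℓ)ˣ) {r : ℕ} (hr : r ≤ n) :
    (satakePoly μ).coeff (n - r) = (-1) ^ r * esymm μ r := by
  rw [satakePoly, charpoly_of_isUpperTriangular _ (blockTriangular_diagonal _)]
  simp only [diagonal_apply_eq]
  have h := Multiset.prod_X_sub_C_coeff
    (Finset.univ.val.map fun j : Fin n => (μ j : PadicAlgCl ℓ)) (k := n - r) (by simp)
  rw [Multiset.map_map] at h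
  rw [Finset.esymm_map_val] at h
  simp only [Multiset.card_map, Finset.card_val, Finset.card_univ, Fintype.card_fin,
    Nat.sub_sub_self hr] at h
  exact h

theorem esymm_self (μ : Fin n → (PadicAlgCl ℓ)ˣ) : esymm μ n = ∏ j, (μ j : PadicAlgCl ℓ) := by
  rw [esymm]
  have huniv : Finset.powersetCard n (Finset.univ : Finset (Fin n)) = {Finset.univ} := by
    simpa using Finset.powersetCard_self (Finset.univ : Finset (Fin n))
  rw [huniv, Finset.sum_singleton]

end Coefficients

section FieldGroups

variable {F : Type*} [Field F] {n : ℕ}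

theorem superdiagSum_oneAdd_single {i j : Fin n} (hij : (j : ℕ) = i + 1) (y : F)
    (h : single i j y * single i j y = 0) : superdiagSum (oneAddGL (single i j y) h) = y := by
  rw [superdiagSum, Finset.sum_eq_single i, Finset.sum_eq_single j, if_pos hij, coe_oneAddGL,
    Matrix.add_apply, one_apply_ne, single_apply_same, zero_add]
  · intro h; rw [h] at hij; omega
  · intro b _ hb
    rw [if_neg]
    intro h
    exact hb (Fin.ext (h.trans hij.symm))
  · simp
  · intro a _ ha
    refine Finset.sum_eq_zero fun b _ => ?_
    split_ifs with hab
    · rw [coe_oneAddGL, Matrix.add_apply, one_apply_ne (by intro h; rw [h] at hab; omega),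
        single_apply_of_ne _ _ _ _ _ (fun h => ha h.1.symm), add_zero]
    · rfl
  · simp

end FieldGroups

/-! ### Satake transforms of the minuscule Hecke operators. -/

section Satake

variable {F : Type*} [Field F] [ValuativeRel F] [IsDiscreteValuationRing 𝒪[F]] {n : ℕ} {ϖ : 𝒪[F]} {t : Fˣ} {ℓ : ℕ} [Fact ℓ.Prime]

theorem unipotentIntegral_ind (hϖ : Irreducible ϖ) (ht : (t : F) = ϖ) (S₀ S : Finset (Fin n))
    (hS : S.card = S₀.card) :
    unipotentIntegral ϖ (torus t (ind S₀)) (ind S) = Nat.card 𝓀[F] ^ Fintype.card (Inv S) := by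
  -- By uniqueness of Iwasawa exponents, the cosets meeting ϖ^S N are exactly those labelled by S.
  have hset : {c : GL (Fin n) F ⧸ maxCompact F n |
      c ∈ MulAction.orbit (maxCompact F n)
        (torus t (ind S₀) : GL (Fin n) F ⧸ maxCompact F n) ∧
      ∃ x u : GL (Fin n) F, IsUpperUnipotent u ∧ (x : Matrix (Fin n) (Fin n) F) =
        diagonal (fun i => (ϖ : F) ^ ind S i) * (u : Matrix (Fin n) (Fin n) F) ∧
      c = (x : GL (Fin n) F ⧸ maxCompact F n)} =
      Set.range fun x : Inv S → 𝓀[F] =>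
        ((repGL t S x : GL (Fin n) F) : GL (Fin n) F ⧸ maxCompact F n) := by
    ext c
    constructor
    · rintro ⟨hc, x, u, hu, hx, rfl⟩
      rw [orbit_eq_range hϖ ht] at hc
      obtain ⟨⟨⟨T, hT⟩, y⟩, hy⟩ := hc
      have hxu : x = (torus t (ind S) * u * (torus t (ind S))⁻¹) * torus t (ind S) := by
        rw [inv_mul_cancel_right]
        ext i j
        rw [hx, torus_mul_apply, diagonal_mul, Units.val_zpow_eq_zpow_val, ht]
      have hTS := ind_injective (torus_exponent_unique hϖ ht (invGL_mem_upperUnipotent _ _)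
        (torus_conj_mem t (ind S) hu) (by rw [← hxu]; exact QuotientGroup.eq.1 hy))
      subst hTS
      exact ⟨y, hy⟩
    · rintro ⟨x, rfl⟩
      refine ⟨repGL_mem_orbit hS x, repGL t S x, _,
        torus_conj_mem' t (ind S) (invGL_mem_upperUnipotent S fun p => (residueLift (x p) : F)),
        ?_, rfl⟩
      have : repGL t S x = torus t (ind S) * ((torus t (ind S))⁻¹ *
          invGL S (fun p => (residueLift (x p) : F)) * torus t (ind S)) := by
        rw [repGL]; group
      ext i j
      rw [this, torus_mul_apply, diagonal_mul, Units.val_zpow_eq_zpow_val, ht]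
  have hinj : Function.Injective fun x : Inv S → 𝓀[F] =>
      ((repGL t S x : GL (Fin n) F) : GL (Fin n) F ⧸ maxCompact F n) :=
    fun x y h => repGL_coset_injective hϖ ht (QuotientGroup.eq.1 h)
  rw [unipotentIntegral]
  change Nat.card (Set.Elem {c | _}) = _
  rw [hset, Nat.card_range_of_injective hinj, Nat.card_fun, Nat.card_eq_fintype_card (α := Inv S)]

theorem unipotentIntegral_eq_zero (hϖ : Irreducible ϖ) (ht : (t : F) = ϖ) (S₀ : Finset (Fin n))
    {a : Fin n → ℤ} (ha : ∀ S : Finset (Fin n), S.card = S₀.card → a ≠ ind S) :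
    unipotentIntegral ϖ (torus t (ind S₀)) a = 0 := by
  rw [unipotentIntegral, Nat.card_eq_zero]
  refine Or.inl ⟨?_⟩
  rintro ⟨c, hc, x, u, hu, hx, rfl⟩
  rw [orbit_eq_range hϖ ht] at hc
  obtain ⟨⟨⟨T, hT⟩, y⟩, hy⟩ := hc
  have hxu : x = (torus t a * u * (torus t a)⁻¹) * torus t a := by
    rw [inv_mul_cancel_right]
    ext i j
    rw [hx, torus_mul_apply, diagonal_mul, Units.val_zpow_eq_zpow_val, ht]
  exact ha T hT (torus_exponent_unique hϖ ht (invGL_mem_upperUnipotent _ _)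
    (torus_conj_mem t a hu) (by rw [← hxu]; exact QuotientGroup.eq.1 hy)).symm

/-- The Satake transform of a minuscule Hecke operator is an elementary symmetric polynomial. -/
theorem satakeTransform_torus_ind [Finite 𝓀[F]] (hϖ : Irreducible ϖ) (ht : (t : F) = ϖ) {sq : PadicAlgCl ℓ}
    (hsq : sq ^ 2 = (Nat.card 𝓀[F] : PadicAlgCl ℓ)) (S₀ : Finset (Fin n))
    (μ : Fin n → (PadicAlgCl ℓ)ˣ) :
    satakeTransform sq ϖ (torus t (ind S₀)) μ =
      sq ^ ((S₀.card : ℤ) * (n - S₀.card)) * esymm μ S₀.card := by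
  have hsq0 : sq ≠ 0 := by
    rintro rfl
    rw [zero_pow two_ne_zero, eq_comm, Nat.cast_eq_zero] at hsq
    exact Nat.card_pos.ne' hsq
  rw [satakeTransform, finsum_eq_sum_of_support_subset
    (s := (Finset.powersetCard S₀.card Finset.univ).image ind)]
  · rw [Finset.sum_image ind_injective.injOn, esymm, Finset.mul_sum]
    refine Finset.sum_congr rfl fun S hS => ?_
    rw [Finset.mem_powersetCard] at hS
    rw [unipotentIntegral_ind hϖ ht S₀ S hS.2, Nat.cast_pow, ← hsq, ← pow_mul, sqrtModulus,
      ← zpow_natCast, ← zpow_add₀ hsq0, ← hS.2, ← card_inv_formula, add_comm]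
    congr 1
    rw [← Finset.prod_subset S.subset_univ]
    · exact Finset.prod_congr rfl fun j hj => by simp [ind, hj]
    · intro j _ hj
      simp [ind, hj]
  · intro a ha
    by_contra hna
    refine ha ?_
    beta_reduce
    rw [unipotentIntegral_eq_zero hϖ ht]
    · simp
    · rintro S hS rfl
      exact hna (by simpa using ⟨S, hS, rfl⟩)

end Satake

/-! ### The recursion for Whittaker values. -/

section Hecke

variable {F : Type*} [Field F] [ValuativeRel F] [IsDiscreteValuationRing 𝒪[F]]
  [Fintype 𝓀[F]] {n : ℕ} {ϖ : 𝒪[F]} {t : Fˣ} {ℓ : ℕ} [Fact ℓ.Prime]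
  {V : Type*} [AddCommGroup V] [Module (PadicAlgCl ℓ) V]
  {π : Representation (PadicAlgCl ℓ) (GL (Fin n) F) V}

theorem heckeOp_torus_ind (hϖ : Irreducible ϖ) (ht : (t : F) = ϖ) (S₀ : Finset (Fin n)) {v : V}
    (hv : IsSpherical π v) :
    heckeOp π (torus t (ind S₀)) v =
      ∑ S ∈ Finset.powersetCard S₀.card Finset.univ, ∑ x : Inv S → 𝓀[F], π (repGL t S x) v := by
  rw [heckeOp, orbit_eq_range hϖ ht, finsum_mem_range (repGL_injective hϖ ht _),
    finsum_eq_sum_of_fintype, Fintype.sum_sigma, Finset.sum_subtype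
    (p := fun S : Finset (Fin n) => S.card = S₀.card) _ (by simp [Finset.mem_powersetCard])]
  refine Finset.sum_congr rfl fun S _ => Finset.sum_congr rfl fun x _ => ?_
  exact apply_eq_of_coset_eq hv (QuotientGroup.out_eq' _)

/-- Moving an integral unipotent to the left past ϖ^l keeps its superdiagonal integral when l is
dominant, so ψ is trivial on it. All cosets with the same S thus contribute equally. -/
theorem whittaker_recursion (hϖ : Irreducible ϖ) (ht : (t : F) = ϖ) {v : V}
    (hv : IsSpherical π v) {ψ : AddChar F (PadicAlgCl ℓ)} (hψ : ∀ x : 𝒪[F], ψ (x : F) = 1)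
    {Λ : V →ₗ[PadicAlgCl ℓ] PadicAlgCl ℓ} (hΛ : IsWhittakerFunctional π ψ Λ)
    {l : Fin n → ℤ} (hl : Antitone l) (S₀ : Finset (Fin n)) :
    ∑ S ∈ Finset.powersetCard S₀.card Finset.univ,
      (Nat.card 𝓀[F] : PadicAlgCl ℓ) ^ Fintype.card (Inv S) * Λ (π (torus t (l + ind S)) v) =
      Λ (π (torus t l) (heckeOp π (torus t (ind S₀)) v)) := by
  rw [heckeOp_torus_ind hϖ ht S₀ hv]
  simp only [map_sum]
  refine Finset.sum_congr rfl fun S _ => ?_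
  have : ∀ x : Inv S → 𝓀[F],
      Λ (π (torus t l) (π (repGL t S x) v)) = Λ (π (torus t (l + ind S)) v) := by
    intro x
    set u := invGL S fun p => (residueLift (x p) : F) with hu
    have huN : u ∈ upperUnipotent := invGL_mem_upperUnipotent _ _
    have huK : u ∈ maxCompact F n := invGL_mem_maxCompact fun p => (residueLift (x p)).2
    have e : torus t l * repGL t S x =
        (torus t l * u * (torus t l)⁻¹) * torus t (l + ind S) := by
      rw [repGL, torus_add, hu]; group
    rw [← Module.End.mul_apply, ← map_mul, e, map_mul, Module.End.mul_apply,
      hΛ _ (torus_conj_mem t l huN)]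
    have hint : superdiagSum (torus t l * u * (torus t l)⁻¹) ∈ 𝒪[F] := by
      refine sum_mem fun i _ => sum_mem fun j _ => ?_
      split_ifs with hij
      · rw [← torus_neg, mul_torus_apply, torus_mul_apply, mul_right_comm, ← Units.val_mul,
          ← _root_.zpow_add]
        refine mul_mem ((zpow_mem_integer_iff hϖ ht).2 ?_) ((mem_maxCompact_iff.1 huK).1 i j)
        have := hl (show i ≤ j from Fin.le_def.2 (by omega))
        simp only [Pi.neg_apply]
        linarith
      · exact zero_mem _
    rw [hψ ⟨_, hint⟩, one_mul]
  rw [Finset.sum_congr rfl fun x _ => this x, Finset.sum_const, Finset.card_univ, Fintype.card_fun,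
    nsmul_eq_mul, Nat.card_eq_fintype_card, Nat.cast_pow]

end Hecke

/-! ### Vanishing on non-dominant weights. -/

section Whittaker

variable {F : Type*} [Field F] [ValuativeRel F] {n : ℕ} {ϖ : 𝒪[F]} {t : Fˣ} {ℓ : ℕ}
  [Fact ℓ.Prime] {V : Type*} [AddCommGroup V] [Module (PadicAlgCl ℓ) V]
  {π : Representation (PadicAlgCl ℓ) (GL (Fin n) F) V}

theorem whittaker_nondominant (hϖ : Irreducible ϖ) (ht : (t : F) = ϖ) {v : V}
    (hv : IsSpherical π v) {ψ : AddChar F (PadicAlgCl ℓ)}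
    (hψ : ∃ x : F, (ϖ : F) * x ∈ 𝒪[F] ∧ ψ x ≠ 1)
    {Λ : V →ₗ[PadicAlgCl ℓ] PadicAlgCl ℓ} (hΛ : IsWhittakerFunctional π ψ Λ)
    {l : Fin n → ℤ} (hl : ¬ Antitone l) : Λ (π (torus t l) v) = 0 := by
  obtain ⟨y, hy, hψy⟩ := hψ
  rw [antitone_iff_forall_covBy] at hl
  push Not at hl
  obtain ⟨i, j, hij, hlt⟩ := hl
  rw [Fin.covBy_iff, Nat.covBy_iff_add_one_eq] at hij
  have hne : i ≠ j := fun h => by rw [h] at hij; omega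
  have hsq : ∀ c : F, single i j c * single i j c = 0 := fun c =>
    single_mul_single_of_ne _ _ _ _ hne.symm _
  set c : F := ((t ^ (l j - l i) : Fˣ) : F) * y with hc
  -- As l i < l j, the conjugate of y gains at least one factor ϖ. The corresponding unipotent then
  -- fixes v, while on the other side of ϖ^l it acts through ψ(y) ≠ 1.
  have hcint : c ∈ 𝒪[F] := by
    have : c = ((t ^ (l j - l i - 1) : Fˣ) : F) * (ϖ * y) := by
      rw [hc, ← ht, ← mul_assoc, ← Units.val_mul, ← _root_.zpow_add_one, sub_add_cancel]
    rw [this]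
    exact mul_mem ((zpow_mem_integer_iff hϖ ht).2 (by omega)) hy
  have hu : oneAddGL (single i j c) (hsq c) ∈ maxCompact F n := by
    refine oneAddGL_mem_maxCompact _ fun a b => ?_
    rw [single_apply]
    split_ifs
    · exact hcint
    · exact zero_mem _
  have huN : oneAddGL (single i j y) (hsq y) ∈ upperUnipotent := by
    refine ⟨fun a => ?_, fun a b hab => ?_⟩
    · rw [coe_oneAddGL, Matrix.add_apply, one_apply_eq,
        single_apply_of_ne _ _ _ _ _ (fun h => hne (h.1.trans h.2.symm)), add_zero]
    · rw [coe_oneAddGL, Matrix.add_apply, one_apply_ne hab.ne', single_apply_of_ne, add_zero]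
      rintro ⟨rfl, rfl⟩
      have := Fin.lt_def.1 hab
      omega
  have e : torus t l * oneAddGL (single i j c) (hsq c) =
      oneAddGL (single i j y) (hsq y) * torus t l := by
    ext a b
    rw [torus_mul_apply, mul_torus_apply, coe_oneAddGL, coe_oneAddGL, Matrix.add_apply,
      Matrix.add_apply, mul_add, add_mul]
    congr 1
    · by_cases hab : a = b
      · subst hab; rw [one_apply_eq, mul_comm]
      · rw [one_apply_ne hab, mul_zero, zero_mul]
    · by_cases hab : i = a ∧ j = b
      · obtain ⟨rfl, rfl⟩ := hab
        rw [single_apply_same, single_apply_same, hc, ← mul_assoc, ← Units.val_mul,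
          ← _root_.zpow_add, add_sub_cancel, mul_comm]
      · rw [single_apply_of_ne _ _ _ _ _ hab, single_apply_of_ne _ _ _ _ _ hab, mul_zero, zero_mul]
  have h1 : Λ (π (torus t l) v) = ψ y * Λ (π (torus t l) v) := by
    conv_lhs => rw [← hv _ hu]
    rw [← Module.End.mul_apply, ← map_mul, e, map_mul, Module.End.mul_apply, hΛ _ huN,
      superdiagSum_oneAdd_single hij.symm]
  have h2 : (ψ y - 1) * Λ (π (torus t l) v) = 0 := by rw [sub_mul, one_mul, ← h1, sub_self]
  exact (mul_eq_zero.1 h2).resolve_left (sub_ne_zero.2 hψy)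

end Whittaker

/-! ### Valuations on the coefficient field and the ring of congruent pairs. -/

section Valuation

variable {ℓ : ℕ} [Fact ℓ.Prime]

theorem mem_Zbar_iff {x : PadicAlgCl ℓ} : x ∈ Zbar ℓ ↔ (PadicAlgCl.valued ℓ).v x ≤ 1 := Iff.rfl

theorem mem_maximalIdeal_valuationSubring_iff {K Γ : Type*} [Field K]
    [LinearOrderedCommGroupWithZero Γ] (v : Valuation K Γ) (m : v.valuationSubring) :
    m ∈ IsLocalRing.maximalIdeal v.valuationSubring ↔ v (m : K) < 1 := by
  have hint : v.Integers v.valuationSubring :=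
    ⟨Subtype.val_injective, fun x => x.2, fun x h => ⟨⟨x, h⟩, rfl⟩⟩
  rw [IsLocalRing.mem_maximalIdeal, mem_nonunits_iff, hint.isUnit_iff_valuation_eq_one]
  exact (lt_iff_le_and_ne.trans (and_iff_right m.2)).symm

theorem congMod_iff {x y : PadicAlgCl ℓ} :
    CongMod ℓ x y ↔ (PadicAlgCl.valued ℓ).v (x - y) < 1 := by
  constructor
  · rintro ⟨m, hm, h⟩
    rw [h]
    exact (mem_maximalIdeal_valuationSubring_iff _ m).1 hm
  · intro h
    exact ⟨⟨x - y, mem_Zbar_iff.2 h.le⟩, (mem_maximalIdeal_valuationSubring_iff _ _).2 h, rfl⟩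

theorem valuation_natCast_le_one (m : ℕ) : (PadicAlgCl.valued ℓ).v (m : PadicAlgCl ℓ) ≤ 1 :=
  mem_Zbar_iff.1 (natCast_mem _ m)

theorem valuation_prime_eq_one {p : ℕ} (hp : p.Prime) (h : ℓ ≠ p) :
    (PadicAlgCl.valued ℓ).v (p : PadicAlgCl ℓ) = 1 := by
  have hℓ : ℓ.Prime := Fact.out
  refine le_antisymm (valuation_natCast_le_one p) ?_
  by_contra! hlt
  have hlℓ : (PadicAlgCl.valued ℓ).v (ℓ : PadicAlgCl ℓ) < 1 := by
    rw [PadicAlgCl.valuation_p, one_div]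
    exact inv_lt_one_of_one_lt₀ (by exact_mod_cast hℓ.one_lt)
  have hco : IsCoprime (ℓ : ℤ) (p : ℤ) :=
    Nat.isCoprime_iff_coprime.2 ((Nat.coprime_primes hℓ hp).2 h)
  obtain ⟨a, b, hab⟩ := hco
  have hZ : ∀ a : ℤ, (PadicAlgCl.valued ℓ).v (a : PadicAlgCl ℓ) ≤ 1 := fun a =>
    mem_Zbar_iff.1 (intCast_mem _ a)
  have h1 : ((a : PadicAlgCl ℓ) * ℓ + b * p) = 1 := by exact_mod_cast congrArg (Int.cast) hab
  have h2 := Valuation.map_add_lt (PadicAlgCl.valued ℓ).v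
    (x := (a : PadicAlgCl ℓ) * ℓ) (y := b * p) (g := 1)
    (by rw [map_mul]; exact mul_lt_one_of_nonneg_of_lt_one_right (hZ a) zero_le hlℓ)
    (by rw [map_mul]; exact mul_lt_one_of_nonneg_of_lt_one_right (hZ b) zero_le hlt)
  rw [h1, map_one] at h2
  exact lt_irrefl _ h2

/-- The ring of pairs of integral elements which are congruent modulo the maximal ideal. -/
def congPairs (ℓ : ℕ) [Fact ℓ.Prime] : Subring (PadicAlgCl ℓ × PadicAlgCl ℓ) where
  carrier := {x | (PadicAlgCl.valued ℓ).v x.1 ≤ 1 ∧ (PadicAlgCl.valued ℓ).v x.2 ≤ 1 ∧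
    (PadicAlgCl.valued ℓ).v (x.1 - x.2) < 1}
  mul_mem' := by
    rintro ⟨a, b⟩ ⟨c, d⟩ ⟨h1, h2, h3⟩ ⟨h4, h5, h6⟩
    refine ⟨(Zbar ℓ).mul_mem _ _ h1 h4, (Zbar ℓ).mul_mem _ _ h2 h5, ?_⟩
    dsimp only [Prod.fst_mul, Prod.snd_mul] at *
    rw [show a * c - b * d = a * (c - d) + d * (a - b) by ring]
    refine Valuation.map_add_lt _ ?_ ?_ <;> rw [map_mul]
    · exact mul_lt_one_of_nonneg_of_lt_one_right h1 zero_le h6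
    · exact mul_lt_one_of_nonneg_of_lt_one_right h5 zero_le h3
  one_mem' := by simp
  add_mem' := by
    rintro ⟨a, b⟩ ⟨c, d⟩ ⟨h1, h2, h3⟩ ⟨h4, h5, h6⟩
    refine ⟨(Zbar ℓ).add_mem _ _ h1 h4, (Zbar ℓ).add_mem _ _ h2 h5, ?_⟩
    dsimp only [Prod.fst_add, Prod.snd_add] at *
    rw [show a + c - (b + d) = (a - b) + (c - d) by ring]
    exact Valuation.map_add_lt _ h3 h6
  zero_mem' := by simp
  neg_mem' := by
    rintro ⟨a, b⟩ ⟨h1, h2, h3⟩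
    refine ⟨(Zbar ℓ).neg_mem _ h1, (Zbar ℓ).neg_mem _ h2, ?_⟩
    dsimp only [Prod.fst_neg, Prod.snd_neg] at *
    rwa [show -a - -b = -(a - b) by ring, Valuation.map_neg]

theorem mk_mem_congPairs {x y : PadicAlgCl ℓ} : (x, y) ∈ congPairs ℓ ↔
    (PadicAlgCl.valued ℓ).v x ≤ 1 ∧ (PadicAlgCl.valued ℓ).v y ≤ 1 ∧
      (PadicAlgCl.valued ℓ).v (x - y) < 1 := Iff.rfl

/-- The identity x⁻¹ - y⁻¹ = -(x - y)x⁻¹y⁻¹ shows that inverses of congruent units are congruent. -/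
theorem isUnit_congPairs {x y : PadicAlgCl ℓ} (h : (x, y) ∈ congPairs ℓ)
    (hx : (PadicAlgCl.valued ℓ).v x = 1) (hy : (PadicAlgCl.valued ℓ).v y = 1) :
    IsUnit (⟨(x, y), h⟩ : congPairs ℓ) := by
  have hx0 : x ≠ 0 := by rintro rfl; simp at hx
  have hy0 : y ≠ 0 := by rintro rfl; simp at hy
  have hinv : (x⁻¹, y⁻¹) ∈ congPairs ℓ := by
    rw [mk_mem_congPairs, map_inv₀, map_inv₀, hx, hy, inv_one,
      show x⁻¹ - y⁻¹ = -(x - y) * (x⁻¹ * y⁻¹) by field_simp; ring, map_mul, map_mul, map_inv₀,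
      map_inv₀, hx, hy, inv_one, mul_one, mul_one, Valuation.map_neg]
    exact ⟨le_rfl, le_rfl, h.2.2⟩
  refine IsUnit.of_mul_eq_one ⟨_, hinv⟩ (Subtype.ext ?_)
  simp [hx0, hy0]

end Valuation

/-! ### Units coming from the residue characteristic. -/

section Residue

variable {F : Type*} [Field F] [ValuativeRel F] [IsDiscreteValuationRing 𝒪[F]] [Finite 𝓀[F]]
  {ϖ : 𝒪[F]} {ℓ : ℕ} [Fact ℓ.Prime]

theorem prime_of_residue_char (p : ℕ) [CharP 𝓀[F] p] : p.Prime := by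
  rcases CharP.char_is_prime_or_zero 𝓀[F] p with h | rfl
  · exact h
  · have := CharP.charP_to_charZero 𝓀[F]
    exact (not_finite 𝓀[F]).elim

theorem valuation_card_residue (p : ℕ) [CharP 𝓀[F] p] (h : ℓ ≠ p) :
    (PadicAlgCl.valued ℓ).v (Nat.card 𝓀[F] : PadicAlgCl ℓ) = 1 := by
  have hp : p.Prime := prime_of_residue_char (F := F) p
  have : Fintype 𝓀[F] := Fintype.ofFinite _
  obtain ⟨m, -, hm⟩ := FiniteField.card 𝓀[F] p
  rw [Nat.card_eq_fintype_card, hm, Nat.cast_pow, map_pow, valuation_prime_eq_one hp h, one_pow]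

/-- Since p is divisible by ϖ, some p^m x is integral, so ψ(x) is a root of unity. -/
theorem valuation_addChar_eq_one (hϖ : Irreducible ϖ) (p : ℕ) [CharP 𝓀[F] p]
    {ψ : AddChar F (PadicAlgCl ℓ)} (hψ : ∀ x : 𝒪[F], ψ (x : F) = 1) (x : F) :
    (PadicAlgCl.valued ℓ).v (ψ x) = 1 := by
  have hp : p.Prime := prime_of_residue_char (F := F) p
  obtain ⟨m, hm⟩ := exists_pow_mul_integral hϖ x
  have hpz : ∃ z ∈ 𝒪[F], (p : F) = ϖ * z := by
    have : IsLocalRing.residue 𝒪[F] (p : 𝒪[F]) = IsLocalRing.residue 𝒪[F] 0 := by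
      rw [map_natCast, CharP.cast_eq_zero, map_zero]
    simpa using (residue_eq_iff hϖ _ _).1 this
  obtain ⟨z, hz, hpz⟩ := hpz
  have hint : (p ^ m) • x ∈ 𝒪[F] := by
    rw [nsmul_eq_mul, Nat.cast_pow, hpz, mul_pow, mul_comm ((ϖ : F) ^ m), mul_assoc]
    exact mul_mem (pow_mem hz m) (hm m le_rfl)
  have h1 := hψ ⟨_, hint⟩
  rw [AddChar.map_nsmul_eq_pow] at h1
  have h2 := congrArg (PadicAlgCl.valued ℓ).v h1
  rw [map_pow, map_one] at h2
  exact (pow_eq_one_iff_of_nonneg zero_le (pow_ne_zero _ hp.ne_zero)).1 h2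

end Residue

/-! ### Primitive vectors in a lattice. -/

section Lattice

variable {ℓ : ℕ} [Fact ℓ.Prime] {V : Type*} [AddCommGroup V] [Module (PadicAlgCl ℓ) V]

/-- In a lattice, a line contains a primitive vector. -/
theorem exists_primitive_vector {B : Set V}
    (hB : LinearIndependent (PadicAlgCl ℓ) ((↑) : B → V))
    (hspan : Submodule.span (PadicAlgCl ℓ) B = ⊤) {v : V} (hv : v ≠ 0) :
    ∃ c : PadicAlgCl ℓ, c • v ∈ Submodule.span (Zbar ℓ) B ∧
      ∀ s : PadicAlgCl ℓ, s • c • v ∈ Submodule.span (Zbar ℓ) B →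
        (PadicAlgCl.valued ℓ).v s ≤ 1 := by
  classical
  let b : Module.Basis B (PadicAlgCl ℓ) V := Module.Basis.mk hB (by simp [hspan])
  have hb : ∀ i : B, b i = i := fun i => Module.Basis.mk_apply _ _ i
  have hcoord : ∀ x ∈ Submodule.span (Zbar ℓ) B, ∀ i, b.repr x i ∈ Zbar ℓ := by
    intro x hx i
    induction hx using Submodule.span_induction with
    | mem x hx =>
      rw [show x = b ⟨x, hx⟩ from (hb ⟨x, hx⟩).symm, b.repr_self, Finsupp.single_apply]
      split_ifs
      · exact one_mem _
      · exact zero_mem _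
    | zero => rw [map_zero]; exact zero_mem _
    | add x y _ _ hx hy => rw [map_add]; exact add_mem hx hy
    | smul a x _ hx =>
      rw [show a • x = (a : PadicAlgCl ℓ) • x from rfl, map_smul]
      exact mul_mem a.2 hx
  have hne : (b.repr v).support.Nonempty := by
    rw [Finsupp.support_nonempty_iff]
    exact fun h => hv (by simpa using h)
  -- Only finitely many coordinates are non-zero, so a largest one exists although the value group
  -- is not discrete. Dividing by it makes all coordinates integral and one equal to 1.
  obtain ⟨i, hi, hmax⟩ := Finset.exists_max_image _
    (fun i => (PadicAlgCl.valued ℓ).v (b.repr v i)) hne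
  have hi0 : b.repr v i ≠ 0 := Finsupp.mem_support_iff.1 hi
  refine ⟨(b.repr v i)⁻¹, ?_, fun s hs => ?_⟩
  · have hsum : v = ∑ j ∈ (b.repr v).support, b.repr v j • b j := by
      conv_lhs => rw [← b.linearCombination_repr v, Finsupp.linearCombination_apply, Finsupp.sum]
    have hc : (b.repr v i)⁻¹ • v = ∑ j ∈ (b.repr v).support, (b.repr v i)⁻¹ • b.repr v j • b j := by
      rw [← Finset.smul_sum, ← hsum]
    rw [hc]
    refine sum_mem fun j hj => ?_
    have hint : (b.repr v i)⁻¹ * b.repr v j ∈ Zbar ℓ := by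
      rw [mem_Zbar_iff, map_mul, map_inv₀, mul_comm, ← div_eq_mul_inv]
      exact div_le_one_of_le₀ (hmax j hj) zero_le
    rw [smul_smul, hb]
    exact Submodule.smul_mem _ (⟨_, hint⟩ : Zbar ℓ) (Submodule.subset_span j.2)
  · have := hcoord _ hs i
    rw [map_smul, map_smul, Finsupp.smul_apply, Finsupp.smul_apply, smul_eq_mul, smul_eq_mul,
      inv_mul_cancel₀ hi0, mul_one] at this
    exact this

end Lattice

/-! ### Formal properties of Whittaker functionals. -/

section Functionals

variable {F : Type*} [Field F] {n : ℕ} {t : Fˣ} {ℓ : ℕ} [Fact ℓ.Prime]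
  {V : Type*} [AddCommGroup V] [Module (PadicAlgCl ℓ) V]
  {π : Representation (PadicAlgCl ℓ) (GL (Fin n) F) V} {v : V} {ψ : AddChar F (PadicAlgCl ℓ)}
  {Λ : V →ₗ[PadicAlgCl ℓ] PadicAlgCl ℓ}

theorem whittaker_iwasawa [ValuativeRel F] (hv : IsSpherical π v) (hΛ : IsWhittakerFunctional π ψ Λ)
    {u k : GL (Fin n) F} (hu : u ∈ upperUnipotent) (a : Fin n → ℤ) (hk : k ∈ maxCompact F n) :
    Λ (π (u * torus t a * k) v) = ψ (superdiagSum u) * Λ (π (torus t a) v) := by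
  rw [map_mul, map_mul, Module.End.mul_apply, Module.End.mul_apply, hv k hk, hΛ u hu]

/-- The vectors whose Whittaker function vanishes form a stable subspace, proper because Λ ≠ 0. -/
theorem eq_zero_of_forall_functional (hπ : π.IsIrreducible) (hΛ : Λ ≠ 0) {w : V}
    (hw : ∀ g, Λ (π g w) = 0) : w = 0 := by
  let W : Submodule (PadicAlgCl ℓ) V :=
    { carrier := {w | ∀ g, Λ (π g w) = 0}
      add_mem' := fun {a b} ha hb g => by rw [map_add, map_add, ha g, hb g, add_zero]
      zero_mem' := fun g => by rw [map_zero, map_zero]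
      smul_mem' := fun c x hx g => by rw [map_smul, map_smul, hx g, smul_zero] }
  have hwW : w ∈ W := hw
  rcases eq_bot_or_eq_top_of_stable hπ W (fun g x hx h => by
    rw [← Module.End.mul_apply, ← map_mul]; exact hx _) with hW | hW
  · rwa [hW, Submodule.mem_bot] at hwW
  · refine absurd (LinearMap.ext fun x => ?_) hΛ
    have hx : x ∈ W := by rw [hW]; trivial
    simpa using hx 1

theorem IsWhittakerFunctional.smul (hΛ : IsWhittakerFunctional π ψ Λ) (c : PadicAlgCl ℓ) :
    IsWhittakerFunctional π ψ (c • Λ) := by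
  intro u hu v
  rw [LinearMap.smul_apply, LinearMap.smul_apply, hΛ u hu, smul_eq_mul, smul_eq_mul, mul_left_comm]

theorem IsWhittakerFunctional.sub {Λ' : V →ₗ[PadicAlgCl ℓ] PadicAlgCl ℓ}
    (hΛ : IsWhittakerFunctional π ψ Λ) (hΛ' : IsWhittakerFunctional π ψ Λ') :
    IsWhittakerFunctional π ψ (Λ - Λ') := by
  intro u hu v
  rw [LinearMap.sub_apply, LinearMap.sub_apply, hΛ u hu, hΛ' u hu, mul_sub]

theorem isSphericalWhittaker_of_apply_eq_one [ValuativeRel F] (hv : IsSpherical π v)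
    (hΛ : IsWhittakerFunctional π ψ Λ) (h1 : Λ v = 1) :
    IsSphericalWhittaker π ψ fun g => Λ (π g v) := by
  refine ⟨⟨Λ, hΛ, v, fun g => rfl⟩, fun g k hk => ?_, by simpa using h1⟩
  change Λ (π (g * k) v) = Λ (π g v)
  rw [map_mul, Module.End.mul_apply, hv k hk]

end Functionals

/-! ### Spherical Whittaker functions and their Hecke eigenvalues. -/

section Spherical

variable {F : Type*} [Field F] [ValuativeRel F] [IsDiscreteValuationRing 𝒪[F]] [Fintype 𝓀[F]]
  {n : ℕ} {ϖ : 𝒪[F]} {t : Fˣ} {ℓ : ℕ} [Fact ℓ.Prime]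
  {V : Type*} [AddCommGroup V] [Module (PadicAlgCl ℓ) V]
  {π : Representation (PadicAlgCl ℓ) (GL (Fin n) F) V}

theorem exists_card_eq {r : ℕ} (hr : r ≤ n) : ∃ S : Finset (Fin n), S.card = r := by
  obtain ⟨S, -, hS⟩ := Finset.exists_subset_card_eq (s := (Finset.univ : Finset (Fin n)))
    (n := r) (by simpa using hr)
  exact ⟨S, hS⟩

/-- The eigenvalue of the `r`-th minuscule Hecke operator. -/
noncomputable def heckeEigenvalue (sq : PadicAlgCl ℓ) (μ : Fin n → (PadicAlgCl ℓ)ˣ) (r : ℕ) :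
    PadicAlgCl ℓ := sq ^ ((r : ℤ) * (n - r)) * esymm μ r

theorem heckeEigenvalue_self (sq : PadicAlgCl ℓ) (μ : Fin n → (PadicAlgCl ℓ)ˣ) :
    heckeEigenvalue sq μ n = ∏ j, (μ j : PadicAlgCl ℓ) := by
  rw [heckeEigenvalue, sub_self, mul_zero, zpow_zero, one_mul, esymm_self]

theorem isUnit_heckeEigenvalue_self (sq : PadicAlgCl ℓ) (μ : Fin n → (PadicAlgCl ℓ)ˣ) :
    IsUnit (heckeEigenvalue sq μ n) := by
  rw [heckeEigenvalue_self, ← Units.coe_prod]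
  exact Units.isUnit _

/-- The spherical vector `v` has Satake parameter `μ`. -/
structure IsSatakeVector (π : Representation (PadicAlgCl ℓ) (GL (Fin n) F) V) (sq : PadicAlgCl ℓ)
    (ϖ : 𝒪[F]) (μ : Fin n → (PadicAlgCl ℓ)ˣ) (v : V) : Prop where
  ne_zero : v ≠ 0
  spherical : IsSpherical π v
  hecke : ∀ g : GL (Fin n) F, heckeOp π g v = satakeTransform sq ϖ g μ • v

variable {sq : PadicAlgCl ℓ} {μ : Fin n → (PadicAlgCl ℓ)ˣ} {v : V} {ψ : AddChar F (PadicAlgCl ℓ)}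
  {Λ : V →ₗ[PadicAlgCl ℓ] PadicAlgCl ℓ}

theorem IsSatakeVector.recursion (h : IsSatakeVector π sq ϖ μ v) (hϖ : Irreducible ϖ)
    (ht : (t : F) = ϖ) (hsq : sq ^ 2 = (Nat.card 𝓀[F] : PadicAlgCl ℓ))
    (hψ : ∀ x : 𝒪[F], ψ (x : F) = 1) (hΛ : IsWhittakerFunctional π ψ Λ)
    {l : Fin n → ℤ} (hl : Antitone l) {r : ℕ} (hr : r ≤ n) :
    ∑ S ∈ Finset.powersetCard r Finset.univ,
      (Nat.card 𝓀[F] : PadicAlgCl ℓ) ^ Fintype.card (Inv S) * Λ (π (torus t (l + ind S)) v) =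
      heckeEigenvalue sq μ r * Λ (π (torus t l) v) := by
  obtain ⟨S₀, rfl⟩ := exists_card_eq hr
  rw [whittaker_recursion hϖ ht h.spherical hψ hΛ hl, h.hecke,
    satakeTransform_torus_ind hϖ ht hsq, map_smul, map_smul, smul_eq_mul, heckeEigenvalue]

/-- The recursion with the zero submodule kills all values on the torus, and the Iwasawa
decomposition spreads this to G. It serves both for normalizing and for comparing functionals. -/
theorem IsSatakeVector.whittaker_eq_zero (h : IsSatakeVector π sq ϖ μ v) (hϖ : Irreducible ϖ)
    (hsq : sq ^ 2 = (Nat.card 𝓀[F] : PadicAlgCl ℓ))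
    (hψ : ∀ x : 𝒪[F], ψ (x : F) = 1) (hψ' : ∃ x : F, (ϖ : F) * x ∈ 𝒪[F] ∧ ψ x ≠ 1)
    (hΛ : IsWhittakerFunctional π ψ Λ) (h0 : Λ v = 0) (g : GL (Fin n) F) : Λ (π g v) = 0 := by
  obtain ⟨t, ht⟩ : ∃ t : Fˣ, (t : F) = ϖ :=
    ⟨Units.mk0 _ fun h => hϖ.ne_zero (Subtype.ext h), rfl⟩
  have hq : IsUnit (Nat.card 𝓀[F] : PadicAlgCl ℓ) :=
    isUnit_iff_ne_zero.2 (Nat.cast_ne_zero.2 Nat.card_pos.ne')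
  obtain ⟨u, hu, a, k, hk, rfl⟩ := exists_iwasawa hϖ ht g
  have := mem_of_hecke_recursion (N := (⊥ : Submodule (PadicAlgCl ℓ) (PadicAlgCl ℓ)))
    (w := fun l => Λ (π (torus t l) v)) hq (isUnit_heckeEigenvalue_self sq μ)
    (fun l hl => by
      rw [whittaker_nondominant hϖ ht h.spherical hψ' hΛ hl]; exact zero_mem _)
    (fun l hl r hr => h.recursion hϖ ht hsq hψ hΛ hl hr)
    (by simpa [torus_zero] using h0) a
  rw [whittaker_iwasawa h.spherical hΛ hu a hk, (Submodule.mem_bot _).1 this, mul_zero]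

theorem IsSatakeVector.functional_ne_zero (h : IsSatakeVector π sq ϖ μ v) (hϖ : Irreducible ϖ)
    (hsq : sq ^ 2 = (Nat.card 𝓀[F] : PadicAlgCl ℓ))
    (hψ : ∀ x : 𝒪[F], ψ (x : F) = 1) (hψ' : ∃ x : F, (ϖ : F) * x ∈ 𝒪[F] ∧ ψ x ≠ 1)
    (hπ : π.IsIrreducible) (hΛ : IsWhittakerFunctional π ψ Λ) (hΛ0 : Λ ≠ 0) : Λ v ≠ 0 :=
  fun h0 => h.ne_zero (eq_zero_of_forall_functional hπ hΛ0
    (h.whittaker_eq_zero hϖ hsq hψ hψ' hΛ h0))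

/-- Uniqueness of the normalized spherical Whittaker function. -/
theorem IsSatakeVector.eq_of_isSphericalWhittaker (h : IsSatakeVector π sq ϖ μ v)
    (hϖ : Irreducible ϖ) (hsq : sq ^ 2 = (Nat.card 𝓀[F] : PadicAlgCl ℓ))
    (hψ : ∀ x : 𝒪[F], ψ (x : F) = 1) (hψ' : ∃ x : F, (ϖ : F) * x ∈ 𝒪[F] ∧ ψ x ≠ 1)
    (hπ : π.IsIrreducible) (hΛ : IsWhittakerFunctional π ψ Λ) (h1 : Λ v = 1)
    {W : GL (Fin n) F → PadicAlgCl ℓ} (hW : IsSphericalWhittaker π ψ W) :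
    W = fun g => Λ (π g v) := by
  obtain ⟨⟨Λ', hΛ', v', hWv⟩, hWK, hW1⟩ := hW
  have hΛ'0 : Λ' ≠ 0 := by
    rintro rfl
    rw [hWv] at hW1
    simp at hW1
  -- Invariance of W passes to the vector, because v' ↦ W is injective on an irreducible
  -- representation.
  have hv' : ∀ k ∈ maxCompact F n, π k v' = v' := by
    intro k hk
    rw [← sub_eq_zero]
    refine eq_zero_of_forall_functional hπ hΛ'0 fun g => ?_
    rw [map_sub, map_sub, ← Module.End.mul_apply, ← map_mul, ← hWv, ← hWv, hWK g k hk, sub_self]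
  have hmem : v' ∈ Submodule.span (PadicAlgCl ℓ) {v} := by
    refine mem_span_of_fixed hπ (finite_orbit hϖ) h.ne_zero h.spherical (fun g => ?_) hv'
    have := h.hecke g
    rw [heckeOp] at this
    rw [this]
    exact Submodule.smul_mem _ _ (Submodule.mem_span_singleton_self v)
  obtain ⟨c, rfl⟩ := Submodule.mem_span_singleton.1 hmem
  have hWg : ∀ g, W g = (c • Λ') (π g v) := fun g => by
    rw [hWv, map_smul, map_smul, LinearMap.smul_apply]
  -- Both functionals take the value 1 at v, so their difference vanishes on all translates of v.
  have hdiff := h.whittaker_eq_zero hϖ hsq hψ hψ' ((hΛ'.smul c).sub hΛ) (by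
    have := hWg 1
    rw [hW1, map_one, Module.End.one_apply] at this
    rw [LinearMap.sub_apply, ← this, h1, sub_self])
  ext g
  rw [hWg, ← sub_eq_zero, ← LinearMap.sub_apply]
  exact hdiff g

/-- The unit and integrality properties of Hecke eigenvalues of integral representations. -/
theorem IsSatakeVector.valuation_heckeEigenvalue (h : IsSatakeVector π sq ϖ μ v)
    (hϖ : Irreducible ϖ) (hsq : sq ^ 2 = (Nat.card 𝓀[F] : PadicAlgCl ℓ)) (hint : IsIntegral π) :
    (∀ r ≤ n, (PadicAlgCl.valued ℓ).v (heckeEigenvalue sq μ r) ≤ 1) ∧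
      (PadicAlgCl.valued ℓ).v (heckeEigenvalue sq μ n) = 1 := by
  obtain ⟨t, ht⟩ : ∃ t : Fˣ, (t : F) = ϖ :=
    ⟨Units.mk0 _ fun h => hϖ.ne_zero (Subtype.ext h), rfl⟩
  obtain ⟨B, hB, hspan, hL⟩ := hint
  obtain ⟨c, hc, hprim⟩ := exists_primitive_vector hB hspan h.ne_zero
  have hle : ∀ r ≤ n, (PadicAlgCl.valued ℓ).v (heckeEigenvalue sq μ r) ≤ 1 := by
    intro r hr
    obtain ⟨S₀, rfl⟩ := exists_card_eq hr
    -- A Hecke operator is a sum of group translates, so it preserves the lattice; acting on a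
    -- primitive vector, its eigenvalue is integral.
    refine hprim _ ?_
    have e := h.hecke (torus t (ind S₀))
    rw [satakeTransform_torus_ind hϖ ht hsq, heckeOp_torus_ind hϖ ht S₀ h.spherical] at e
    rw [smul_comm, heckeEigenvalue, ← e, Finset.smul_sum]
    refine sum_mem fun S _ => ?_
    rw [Finset.smul_sum]
    refine sum_mem fun x _ => ?_
    rw [← map_smul]
    exact hL _ _ hc
  refine ⟨hle, le_antisymm (hle n le_rfl) ?_⟩
  have hu := isUnit_heckeEigenvalue_self sq μ
  have e : π (torus t fun _ => 1) v = heckeEigenvalue sq μ n • v := by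
    have e := h.hecke (torus t (ind Finset.univ))
    have huniv : Finset.powersetCard n (Finset.univ : Finset (Fin n)) = {Finset.univ} := by
      simpa using Finset.powersetCard_self (Finset.univ : Finset (Fin n))
    rw [satakeTransform_torus_ind hϖ ht hsq, heckeOp_torus_ind hϖ ht _ h.spherical,
      Finset.card_univ, Fintype.card_fin, huniv, Finset.sum_singleton, Fintype.sum_unique] at e
    rw [heckeEigenvalue, ← e, repGL, ind_univ]
    congr 2
    have : ∀ x : Inv (Finset.univ : Finset (Fin n)) → F, invGL Finset.univ x = 1 := by
      intro x
      ext i j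
      rw [invGL, coe_oneAddGL, Matrix.add_apply, invMatrix_apply_of_not _ (by simp), add_zero]
      rfl
    rw [this, one_mul]
  -- For r = n the operator is the action of the scalar matrix ϖ, whose inverse also preserves the
  -- lattice.
  have h1 : (heckeEigenvalue sq μ n)⁻¹ • c • v ∈ Submodule.span (Zbar ℓ) B := by
    have := hL (torus t fun _ => 1)⁻¹ _ hc
    have e2 : π (torus t fun _ => 1)⁻¹ v = (heckeEigenvalue sq μ n)⁻¹ • v := by
      have h2 : v = (heckeEigenvalue sq μ n)⁻¹ • π (torus t fun _ => 1) v := by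
        rw [e, smul_smul, inv_mul_cancel₀ hu.ne_zero, one_smul]
      conv_lhs => rw [h2]
      rw [map_smul, ← Module.End.mul_apply, ← map_mul, inv_mul_cancel, map_one,
        Module.End.one_apply]
    rwa [map_smul, e2, smul_comm] at this
  have h2 := hprim _ h1
  rw [map_inv₀] at h2
  exact (inv_le_one₀ (by rw [zero_lt_iff, Valuation.ne_zero_iff]; exact hu.ne_zero)).1 h2

/-- Spherical Whittaker functions with congruent Hecke eigenvalues are congruent. -/
theorem whittaker_pair_mem_congPairs
    {V₂ : Type*} [AddCommGroup V₂] [Module (PadicAlgCl ℓ) V₂]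
    {π₂ : Representation (PadicAlgCl ℓ) (GL (Fin n) F) V₂} {μ₂ : Fin n → (PadicAlgCl ℓ)ˣ} {v₂ : V₂}
    {Λ₂ : V₂ →ₗ[PadicAlgCl ℓ] PadicAlgCl ℓ}
    (h : IsSatakeVector π sq ϖ μ v) (h₂ : IsSatakeVector π₂ sq ϖ μ₂ v₂) (hϖ : Irreducible ϖ)
    (ht : (t : F) = ϖ) (hsq : sq ^ 2 = (Nat.card 𝓀[F] : PadicAlgCl ℓ))
    (hq : (PadicAlgCl.valued ℓ).v (Nat.card 𝓀[F] : PadicAlgCl ℓ) = 1)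
    (hψ : ∀ x : 𝒪[F], ψ (x : F) = 1) (hψ' : ∃ x : F, (ϖ : F) * x ∈ 𝒪[F] ∧ ψ x ≠ 1)
    (hΛ : IsWhittakerFunctional π ψ Λ) (hΛ₂ : IsWhittakerFunctional π₂ ψ Λ₂)
    (h1 : Λ v = 1) (h1₂ : Λ₂ v₂ = 1)
    (heig : ∀ r ≤ n, (heckeEigenvalue sq μ r, heckeEigenvalue sq μ₂ r) ∈ congPairs ℓ)
    (hn : (PadicAlgCl.valued ℓ).v (heckeEigenvalue sq μ n) = 1)
    (hn₂ : (PadicAlgCl.valued ℓ).v (heckeEigenvalue sq μ₂ n) = 1) (l : Fin n → ℤ) :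
    (Λ (π (torus t l) v), Λ₂ (π₂ (torus t l) v₂)) ∈ congPairs ℓ := by
  classical
  have hqmem : ((Nat.card 𝓀[F] : PadicAlgCl ℓ), (Nat.card 𝓀[F] : PadicAlgCl ℓ)) ∈ congPairs ℓ :=
    natCast_mem (congPairs ℓ) _
  -- The recursion only involves r ≤ n; the value 0 beyond is never used.
  let s : ℕ → congPairs ℓ := fun r => if hr : r ≤ n then ⟨_, heig r hr⟩ else 0
  have hs : ∀ r (hr : r ≤ n), s r = ⟨_, heig r hr⟩ := fun r hr => dif_pos hr
  let N : Submodule (congPairs ℓ) (PadicAlgCl ℓ × PadicAlgCl ℓ) :=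
    { carrier := congPairs ℓ
      add_mem' := add_mem
      zero_mem' := zero_mem _
      smul_mem' := fun c x hx => mul_mem c.2 hx }
  refine mem_of_hecke_recursion (N := N)
    (w := fun l => (Λ (π (torus t l) v), Λ₂ (π₂ (torus t l) v₂)))
    (isUnit_congPairs hqmem hq hq) (s := s) ?_ ?_ ?_ ?_ l
  · rw [hs n le_rfl]
    exact isUnit_congPairs _ hn hn₂
  · intro l hl
    rw [whittaker_nondominant hϖ ht h.spherical hψ' hΛ hl,
      whittaker_nondominant hϖ ht h₂.spherical hψ' hΛ₂ hl]
    exact zero_mem (congPairs ℓ)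
  · intro l hl r hr
    rw [hs r hr]
    refine Prod.ext ?_ ?_
    · rw [Prod.fst_sum]
      exact h.recursion hϖ ht hsq hψ hΛ hl hr
    · rw [Prod.snd_sum]
      exact h₂.recursion hϖ ht hsq hψ hΛ₂ hl hr
  · rw [torus_zero, map_one, map_one, Module.End.one_apply, Module.End.one_apply, h1, h1₂]
    exact one_mem (congPairs ℓ)

end Spherical

/-! ### Normalization and congruence of the eigenvalues. -/

section Final

variable {F : Type*} [Field F] [ValuativeRel F] [IsDiscreteValuationRing 𝒪[F]] [Fintype 𝓀[F]]
  {n : ℕ} {ϖ : 𝒪[F]} {ℓ : ℕ} [Fact ℓ.Prime]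
  {V : Type*} [AddCommGroup V] [Module (PadicAlgCl ℓ) V]
  {π : Representation (PadicAlgCl ℓ) (GL (Fin n) F) V} {sq : PadicAlgCl ℓ}

theorem exists_normalized_functional {μ : Fin n → (PadicAlgCl ℓ)ˣ}
    {ψ : AddChar F (PadicAlgCl ℓ)} (hϖ : Irreducible ϖ)
    (hsq : sq ^ 2 = (Nat.card 𝓀[F] : PadicAlgCl ℓ))
    (hψ : ∀ x : 𝒪[F], ψ (x : F) = 1) (hψ' : ∃ x : F, (ϖ : F) * x ∈ 𝒪[F] ∧ ψ x ≠ 1)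
    (hπ : π.IsIrreducible) (hgen : IsGeneric π ψ) (hμ : IsSatakeParameter π sq ϖ μ) :
    ∃ (v : V) (Λ : V →ₗ[PadicAlgCl ℓ] PadicAlgCl ℓ), IsSatakeVector π sq ϖ μ v ∧
      IsWhittakerFunctional π ψ Λ ∧ Λ v = 1 := by
  obtain ⟨v, hv0, hv, hT⟩ := hμ
  obtain ⟨Λ, hΛ0, hΛ⟩ := hgen
  have h : IsSatakeVector π sq ϖ μ v := ⟨hv0, hv, hT⟩
  have hne := h.functional_ne_zero hϖ hsq hψ hψ' hπ hΛ hΛ0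
  exact ⟨v, (Λ v)⁻¹ • Λ, h, hΛ.smul _, by simp [hne]⟩

/-- The factor sq^(r(n-r)) is a unit, so the congruence is that of the coefficients of degree n - r,
which are the e_r up to a common sign. -/
theorem heckeEigenvalue_mem_congPairs {μ₁ μ₂ : Fin n → (PadicAlgCl ℓ)ˣ}
    (hsq : (PadicAlgCl.valued ℓ).v sq = 1)
    (hcong : PolyCongMod ℓ (satakePoly μ₁) (satakePoly μ₂)) {r : ℕ} (hr : r ≤ n)
    (h₁ : (PadicAlgCl.valued ℓ).v (heckeEigenvalue sq μ₁ r) ≤ 1)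
    (h₂ : (PadicAlgCl.valued ℓ).v (heckeEigenvalue sq μ₂ r) ≤ 1) :
    (heckeEigenvalue sq μ₁ r, heckeEigenvalue sq μ₂ r) ∈ congPairs ℓ := by
  refine mk_mem_congPairs.2 ⟨h₁, h₂, ?_⟩
  have h := congMod_iff.1 (hcong (n - r))
  rw [satakePoly_coeff _ hr, satakePoly_coeff _ hr, ← mul_sub, map_mul, map_pow, Valuation.map_neg,
    map_one, one_pow, one_mul] at h
  rwa [heckeEigenvalue, heckeEigenvalue, ← mul_sub, map_mul, map_zpow₀, hsq, _root_.one_zpow, one_mul]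

end Final

end WhittakerCong

theorem proposition2p4
    {F : Type*} [Field F] [ValuativeRel F] [TopologicalSpace F] [IsNonarchimedeanLocalField F]
    (n : ℕ) (hn : 1 ≤ n)
    (p : ℕ) [CharP 𝓀[F] p] (ℓ : ℕ) [Fact ℓ.Prime] (hℓp : ℓ ≠ p)
    (ϖ : 𝒪[F]) (hϖ : Irreducible ϖ)
    (sq : PadicAlgCl ℓ) (hsq : sq ^ 2 = (Nat.card 𝓀[F] : PadicAlgCl ℓ))
    (ψ : AddChar F (PadicAlgCl ℓ))
    (hψ : ∀ x : 𝒪[F], ψ (x : F) = 1)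
    (hψ' : ∃ x : F, (ϖ : F) * x ∈ 𝒪[F] ∧ ψ x ≠ 1)
    {V₁ : Type*} [AddCommGroup V₁] [Module (PadicAlgCl ℓ) V₁]
    {V₂ : Type*} [AddCommGroup V₂] [Module (PadicAlgCl ℓ) V₂]
    (π₁ : Representation (PadicAlgCl ℓ) (GL (Fin n) F) V₁)
    (π₂ : Representation (PadicAlgCl ℓ) (GL (Fin n) F) V₂)
    (hsm₁ : WhittakerCong.IsSmooth π₁) (hsm₂ : WhittakerCong.IsSmooth π₂)
    (hirr₁ : π₁.IsIrreducible) (hirr₂ : π₂.IsIrreducible)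
    (hgen₁ : WhittakerCong.IsGeneric π₁ ψ) (hgen₂ : WhittakerCong.IsGeneric π₂ ψ)
    (hunr₁ : WhittakerCong.IsUnramified π₁) (hunr₂ : WhittakerCong.IsUnramified π₂)
    (hint₁ : WhittakerCong.IsIntegral π₁) (hint₂ : WhittakerCong.IsIntegral π₂)
    (μ₁ μ₂ : Fin n → (PadicAlgCl ℓ)ˣ)
    (hμ₁ : WhittakerCong.IsSatakeParameter π₁ sq ϖ μ₁)
    (hμ₂ : WhittakerCong.IsSatakeParameter π₂ sq ϖ μ₂)
    (hcong : WhittakerCong.PolyCongMod ℓ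
      (WhittakerCong.satakePoly μ₁) (WhittakerCong.satakePoly μ₂)) :
    ∃ W₁ W₂ : GL (Fin n) F → PadicAlgCl ℓ,
      (WhittakerCong.IsSphericalWhittaker π₁ ψ W₁ ∧
        ∀ W, WhittakerCong.IsSphericalWhittaker π₁ ψ W → W = W₁) ∧
      (WhittakerCong.IsSphericalWhittaker π₂ ψ W₂ ∧
        ∀ W, WhittakerCong.IsSphericalWhittaker π₂ ψ W → W = W₂) ∧
      (∀ g, W₁ g ∈ WhittakerCong.Zbar ℓ) ∧ (∀ g, W₂ g ∈ WhittakerCong.Zbar ℓ) ∧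
      ∀ g, WhittakerCong.CongMod ℓ (W₁ g) (W₂ g) := by
  open WhittakerCong in
  have : Fintype 𝓀[F] := Fintype.ofFinite _
  obtain ⟨t, ht⟩ : ∃ t : Fˣ, (t : F) = ϖ :=
    ⟨Units.mk0 _ fun h => hϖ.ne_zero (Subtype.ext h), rfl⟩
  obtain ⟨v₁, Λ₁, h₁, hΛ₁, hv₁⟩ :=
    exists_normalized_functional hϖ hsq hψ hψ' hirr₁ hgen₁ hμ₁
  obtain ⟨v₂, Λ₂, h₂, hΛ₂, hv₂⟩ :=
    exists_normalized_functional hϖ hsq hψ hψ' hirr₂ hgen₂ hμ₂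
  have hq := valuation_card_residue (F := F) (ℓ := ℓ) p hℓp
  have hsq1 : (PadicAlgCl.valued ℓ).v sq = 1 := by
    rw [← hsq, map_pow] at hq
    exact (pow_eq_one_iff_of_nonneg zero_le two_ne_zero).1 hq
  obtain ⟨hle₁, hn₁⟩ := h₁.valuation_heckeEigenvalue hϖ hsq hint₁
  obtain ⟨hle₂, hn₂⟩ := h₂.valuation_heckeEigenvalue hϖ hsq hint₂
  have hpair := whittaker_pair_mem_congPairs h₁ h₂ hϖ ht hsq hq hψ hψ' hΛ₁ hΛ₂ hv₁ hv₂
    (fun r hr => heckeEigenvalue_mem_congPairs hsq1 hcong hr (hle₁ r hr) (hle₂ r hr)) hn₁ hn₂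
  -- Off the torus both values are multiplied by the same unit ψ(u).
  have hall : ∀ g, (Λ₁ (π₁ g v₁), Λ₂ (π₂ g v₂)) ∈ congPairs ℓ := by
    intro g
    obtain ⟨u, hu, a, k, hk, rfl⟩ := exists_iwasawa hϖ ht g
    obtain ⟨i₁, i₂, i₃⟩ := mk_mem_congPairs.1 (hpair a)
    rw [whittaker_iwasawa h₁.spherical hΛ₁ hu a hk, whittaker_iwasawa h₂.spherical hΛ₂ hu a hk,
      mk_mem_congPairs, ← mul_sub, map_mul, map_mul, map_mul,
      valuation_addChar_eq_one hϖ p hψ, one_mul, one_mul, one_mul]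
    exact ⟨i₁, i₂, i₃⟩
  exact ⟨fun g => Λ₁ (π₁ g v₁), fun g => Λ₂ (π₂ g v₂),
    ⟨isSphericalWhittaker_of_apply_eq_one h₁.spherical hΛ₁ hv₁, fun W hW =>
      h₁.eq_of_isSphericalWhittaker hϖ hsq hψ hψ' hirr₁ hΛ₁ hv₁ hW⟩,
    ⟨isSphericalWhittaker_of_apply_eq_one h₂.spherical hΛ₂ hv₂, fun W hW =>
      h₂.eq_of_isSphericalWhittaker hϖ hsq hψ hψ' hirr₂ hΛ₂ hv₂ hW⟩,
    fun g => mem_Zbar_iff.2 (hall g).1, fun g => mem_Zbar_iff.2 (hall g).2.1,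
    fun g => congMod_iff.2 (hall g).2.2⟩
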